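/- Let $(\mathcal S,d)$ be a complete metric space and let $\phi:\mathcal S\to(-\infty,+\infty]$, $g:\mathcal S\to[0,+\infty]$ be lower semicontinuous. Suppose that there are $A,B>0$ and $x_\star\in\mathcal S$ with $\phi(x)\ge -A-B\,d^2(x,x_\star)$ for all $x\in\mathcal S$. A curve $u:[0,+\infty)\to\mathcal S$ is locally absolutely continuous if there is $m\in L^1_{\rm loc}([0,+\infty))$ with $d(u(s),u(t))\le\int_s^t m(r)\,dr$ for all $0\le s\le t$; then $|u'|(t):=\lim_{s\to t}\frac{d(u(s),u(t))}{|s-t|}$ exists for a.e. $t$. Let $\mathcal U=\mathcal U(\phi,g)$ be the family of all locally absolutely continuous curves $u:[0,+\infty)\to\mathcal S$ with $\phi(u(0))<+\infty$, $g\circ u$ Borel, and $$\phi(u(s))-\phi(u(t))\ \ge\ \tfrac12\int_s^t g^2(u(r))\,dr+\tfrac12\int_s^t|u'|^2(r)\,dr\qquad\text{for all }0\le s\le t<+\infty.$$ Suppose that $\mathcal U\ne\emptyset$ and that $\phi\circ u$ is continuous on $[0,+\infty)$ for every $u\in\mathcal U$. Notation. For a curve $u$ let $\mathcal R[u]:=u([0,+\infty))$,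 $\overline{\mathcal R[u]}:=\mathcal R[u]\cup\{x\in\mathcal S:\exists\,t_n\to+\infty,\ u(t_n)\to x\}$ and $T_\star(u):=\inf\{s\ge0: u(t)=u(s)\text{ for all }t\ge s\}\in[0,+\infty]$. Write $u\succ v$ if $\mathcal R[v]\subset\overline{\mathcal R[u]}$ and there is an increasing $1$-Lipschitz map $\mathsf z:[0,+\infty)\to[0,+\infty)$ with $\mathsf z(0)=0$ and $u(t)=v(\mathsf z(t))$ for all $t\ge0$. Let $\mathcal U_{\min}$ be the set of $u\in\mathcal U$ such that $u\succ v$, $v\in\mathcal U$, implies $u=v$. Let $\mathcal T[\mathcal U]$ be the set of all curves $t\mapsto u(t\wedge T)$ with $u\in\mathcal U$, $T\in[0,+\infty]$. For $y\in\mathcal U$ let $\mathcal U[\mathcal R[y]]$ be the set of all $w\in\mathcal U$ with $\mathcal R[y]\subset\mathcal R[w]\subset\overline{\mathcal R[y]}$ such that, for some $\theta\in(0,+\infty]$, $w([0,\theta))=\mathcal R[y]$ and $w([\theta,+\infty))\subset\overline{\mathcal R[y]}\setminus\mathcal R[y]$. Then $\mathcal U$ is a generalized $\Lambda$-semiflow,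 that is, it is nonempty and: * (H1) if $u\in\mathcal U$ and $\tau\ge0$, then $u(\cdot+\tau)\in\mathcal U$; * (H2) if $u,v\in\mathcal U$ and $v(0)=u(\bar t)$, then the curve equal to $u(t)$ for $t\le\bar t$ and to $v(t-\bar t)$ for $t>\bar t$ belongs to $\mathcal U$; * (H3) if $u,v\in\mathcal U$, $v([s,t])\subset\mathcal R[u]$ with $s<t$, $l_1,l_2\in[s,t]$, $v(l_1)=u(r_1)\ne u(r_2)=v(l_2)$ and $r_1<r_2$, then $l_1<l_2$; * (H4) if $u\in\mathcal U$, $\theta<+\infty$, $w:[0,\theta)\to\mathcal S$ is such that $w|_{[0,T]}$ extends to a curve in $\mathcal U$ for every $T\in[0,\theta)$, and $w([0,\theta))=\mathcal R[u]$, then $w_\star:=\lim_{t\to+\infty}u(t)$ exists and the extension of $w$ by the constant value $w_\star$ on $[\theta,+\infty)$ belongs to $\mathcal U$; * (H5) if $w:[0,+\infty)\to\mathcal S$ is such that $w|_{[0,T]}$ extends to a curve in $\mathcal U$ for every $T>0$, then $w\in\mathcal U$. Moreover, $\mathcal U$ satisfies the compactness hypothesis * (C) if $v_n\in\mathcal T[\mathcal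 U]$ $(n\in\mathbb N)$, $\sup_nT_\star(v_n)<+\infty$ and $\mathcal R[v_n]=\mathcal R[v_1]$ for all $n$, then there are $v\in\mathcal T[\mathcal U]$ and a subsequence $n_k\uparrow+\infty$ with $v_{n_k}(t)\to v(t)$ for all $t\ge0$ and $\mathcal R[v]=\mathcal R[v_1]$, and the following statements hold. 1. For every $y\in\mathcal U$ there is a unique $u\in\mathcal U[\mathcal R[y]]\cap\mathcal U_{\min}$, and $v\succ u$ for every $v\in\mathcal U[\mathcal R[y]]$. 2. Every $u\in\mathcal U_{\min}$ is injective on $[0,T_\star(u))$. 3. If $u\in\mathcal U_{\min}$, $v\in\mathcal U$, $u\in\mathcal U[\mathcal R[v]]$ and $u(t_0)=v(t_1)$, then $t_0\wedge T_\star(u)\le t_1$. 4. If $u\in\mathcal U_{\min}$, $v\in\mathcal U$ and $v([s_1,t_1])=u([s_0,t_0])$ with $0\le s_i\le t_i$, then $t_0\wedge T_\star(u)-s_0\le t_1-s_1$. 5. If $u\in\mathcal U$ and, for every $v\in\mathcal U[\mathcal R[u]]$, $u(t_0)=v(t_1)$ implies $t_0\wedge T_\star(u)\le t_1$, then $u\in\mathcal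 U_{\min}$. 6. For every $u\in\mathcal U$, $\phi\circ u$ is finite and decreasing and $\phi$ is injective on $\mathcal R[u]$. If $u\in\mathcal U_{\min}$, $v\in\mathcal U$ and $u\in\mathcal U[\mathcal R[v]]$, then $\phi(u(t))\le\phi(v(t))$ for all $t\ge0$. Conversely, if $u\in\mathcal U$ and $\phi(u(t))\le\phi(v(t))$ for all $v\in\mathcal U[\mathcal R[u]]$ and $t\ge0$, then $u\in\mathcal U_{\min}$. 7. Let $\Psi:\mathcal S\to\mathbb R$ satisfy $\Psi(u(t))\le\Psi(u(s))$ for all $u\in\mathcal U$ and $0\le s<t$. If $u\in\mathcal U_{\min}$, $v\in\mathcal U$ and $u\in\mathcal U[\mathcal R[v]]$, then $\Psi(u(t))\le\Psi(v(t))$ for all $t\ge0$. If $u\in\mathcal U$, $\Psi$ is injective on $\mathcal R[u]$, and $\Psi(u(t))\le\Psi(v(t))$ for all $v\in\mathcal U[\mathcal R[u]]$ and $t\ge0$, then $u\in\mathcal U_{\min}$. -/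

import Mathlib

open Filter Set MeasureTheory Topology
open scoped NNReal ENNReal

noncomputable section

namespace LambdaSemiflow

/-! Curves `[0, +∞) → S` are functions `ℝ≥0 → S`; families of curves are sets of such functions. -/

section Abstract

variable {S : Type*}

/-- `inf {s ≥ 0 | u(t) = u(s) for all t ≥ s} ∈ [0, +∞]`, with `inf ∅ = +∞`. This is `T_⋆(u)` for a
solution `u` and `ρ(u)` for a truncated solution `u`. -/
def restTime (u : ℝ≥0 → S) : ℝ≥0∞ :=
  sInf {a : ℝ≥0∞ | ∃ s : ℝ≥0, a = (s : ℝ≥0∞) ∧ ∀ t : ℝ≥0, s ≤ t → u t = u s}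

/-- The truncated solutions `t ↦ u(t ∧ T)`, `u ∈ U`, `T ∈ [0, +∞]`. -/
def truncated (U : Set (ℝ≥0 → S)) : Set (ℝ≥0 → S) :=
  {v | ∃ u ∈ U, ∃ T : ℝ≥0∞, ∀ t : ℝ≥0, v t = u (min (t : ℝ≥0∞) T).toNNReal}

variable [TopologicalSpace S]

/-- The range of `u` together with its limit points along sequences of times tending to `+∞`. -/
def rangeClosure (u : ℝ≥0 → S) : Set S :=
  range u ∪ {x | ∃ t : ℕ → ℝ≥0, Tendsto t atTop atTop ∧ Tendsto (fun n => u (t n)) atTop (𝓝 x)}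

/-- Generalized `Λ`-semiflows on `S`. -/
structure IsGeneralizedLambdaSemiflow (U : Set (ℝ≥0 → S)) : Prop where
  nonempty : U.Nonempty
  translation : ∀ u ∈ U, ∀ τ : ℝ≥0, (fun t => u (t + τ)) ∈ U
  concatenation : ∀ u ∈ U, ∀ v ∈ U, ∀ a : ℝ≥0, v 0 = u a →
    (fun t => if t ≤ a then u t else v (t - a)) ∈ U
  direction : ∀ u ∈ U, ∀ v ∈ U, ∀ s t : ℝ≥0, s < t → v '' Icc s t ⊆ range u →
    ∀ l₁ ∈ Icc s t, ∀ l₂ ∈ Icc s t, ∀ r₁ r₂ : ℝ≥0,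
      v l₁ = u r₁ → v l₂ = u r₂ → u r₁ ≠ u r₂ → r₁ < r₂ → l₁ < l₂
  /-- Only the values of `w` on `[0, θ)` enter. -/
  extension : ∀ u ∈ U, ∀ (θ : ℝ≥0) (w : ℝ≥0 → S),
    (∀ T : ℝ≥0, T < θ → ∃ v ∈ U, ∀ t ≤ T, v t = w t) →
    w '' Iio θ = range u →
    ∃ x : S, Tendsto u atTop (𝓝 x) ∧ (fun t => if t < θ then w t else x) ∈ U
  locality : ∀ w : ℝ≥0 → S,
    (∀ T : ℝ≥0, 0 < T → ∃ v ∈ U, ∀ t ≤ T, v t = w t) → w ∈ U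

/-- The relation `u ≻ v`. -/
def Succeeds (u v : ℝ≥0 → S) : Prop :=
  range v ⊆ rangeClosure u ∧
    ∃ z : ℝ≥0 → ℝ≥0, Monotone z ∧ LipschitzWith 1 z ∧ z 0 = 0 ∧ ∀ t, u t = v (z t)

/-- The minimal elements of `U`. -/
def minimalSolutions (U : Set (ℝ≥0 → S)) : Set (ℝ≥0 → S) :=
  {u | u ∈ U ∧ ∀ v ∈ U, Succeeds u v → u = v}

/-- The compactness hypothesis (C). -/
def CompactnessHypothesis (U : Set (ℝ≥0 → S)) : Prop :=
  ∀ v : ℕ → ℝ≥0 → S, (∀ n, v n ∈ truncated U) → (⨆ n, restTime (v n)) < ⊤ →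
    (∀ n, range (v n) = range (v 0)) →
    ∃ w ∈ truncated U, ∃ k : ℕ → ℕ, StrictMono k ∧
      (∀ t, Tendsto (fun n => v (k n) t) atTop (𝓝 (w t))) ∧ range w = range (v 0)

/-- The class `U[R]` for the range `R = range y` of a solution `y`. -/
def solutionsOnRange (U : Set (ℝ≥0 → S)) (y : ℝ≥0 → S) : Set (ℝ≥0 → S) :=
  {w | w ∈ U ∧ range y ⊆ range w ∧ range w ⊆ rangeClosure y ∧
    ∃ θ : ℝ≥0∞, 0 < θ ∧ w '' {t : ℝ≥0 | (t : ℝ≥0∞) < θ} = range y ∧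
      w '' {t : ℝ≥0 | θ ≤ (t : ℝ≥0∞)} ⊆ rangeClosure y \ range y}

end Abstract

section GradientFlow

variable {S : Type*} [MetricSpace S]

/-- Locally absolutely continuous curves `[0, +∞) → S`. -/
def IsLocAbsContinuous (v : ℝ≥0 → S) : Prop :=
  ∃ m : ℝ → ℝ, LocallyIntegrableOn m (Ici 0) ∧
    ∀ s t : ℝ≥0, s ≤ t → dist (v s) (v t) ≤ ∫ r in (s : ℝ)..t, m r

/-- The metric derivative `|v'|(t) = lim_{s → t} d(v(s), v(t)) / |s - t|`. For a locally absolutely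
continuous curve the limit exists for almost every `t`; the upper limit is a total version of it. -/
def metricDeriv (v : ℝ≥0 → S) (t : ℝ≥0) : ℝ≥0∞ :=
  limsup (fun s => edist (v s) (v t) / edist s t) (𝓝[≠] t)

/-- The family of locally absolutely continuous curves, starting in the effective domain of `φ`,
which satisfy the energy dissipation inequality for `φ` and `g` (with `g ∘ u` Borel). Here `φ` takes
values in `(-∞, +∞]`; the inequality between `s = 0` and `t` forces `φ (u t) < ⊤`, because
`a - ⊤ = ⊥` in `EReal` for every `a`. -/
def gradientFlow (φ : S → EReal) (g : S → ℝ≥0∞) : Set (ℝ≥0 → S) :=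
  {u | IsLocAbsContinuous u ∧ φ (u 0) < ⊤ ∧ Measurable (fun t => g (u t)) ∧
    ∀ s t : ℝ≥0, s ≤ t →
      ((2⁻¹ * (∫⁻ r in Ioc (s : ℝ) t, g (u r.toNNReal) ^ 2) +
        2⁻¹ * (∫⁻ r in Ioc (s : ℝ) t, metricDeriv u r.toNNReal ^ 2) : ℝ≥0∞) : EReal)
        ≤ φ (u s) - φ (u t)}

end GradientFlow

end LambdaSemiflow

end

open LambdaSemiflow

/-!
The theorem rests on a derivative-free form of the energy dissipation inequality: for lower
semicontinuous `g`, a curve `u` belongs to `gradientFlow φ g` if and only if `φ ∘ u` is finite and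

  `∫_s^t g²(u(r)) dr + d²(u(s), u(t)) / (t - s) ≤ 2 (φ(u(s)) - φ(u(t)))`  for all `s ≤ t`

(`IsDissipative`, `mem_gradientFlow_iff`). The inequality follows from the original one by the
Cauchy–Schwarz inequality. Conversely, it says that `d²(u(s), u(t)) ≤ (t - s)(h(t) - h(s))` for an
increasing function `h`. Hence `u` is absolutely continuous and `|u'|² ≤ h'` almost everywhere,
while `∫_s^t h' ≤ h(t) - h(s)`; neither the existence of the metric derivative nor its measurability is
needed. In this form the inequality is stable under translation, concatenation (`(d, h) ↦ d² / h` is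
subadditive) and pointwise limits along which the energy converges (`dissipatesOn_of_tendsto`).
It makes solutions Hölder continuous, and it shows that a solution rests between two times of equal
energy. So `φ` is injective on the range of a solution, and solutions on the same range differ by a
monotone change of time.

For the extension property, the quadratic lower bound on `φ` keeps the energy bounded in finite time
(`exists_le_energy_of_lt`), so that the curve converges. Compactness holds for solutions with values
in compact pieces of the range of one solution, where `φ` is continuous
(`exists_subseq_tendsto_of_mem_image`).

To find the minimal solution on the range of `y`, let `τ(p)` be the least time in which a solution
reaches the point `p` from `y(0)` along the range (`reachTime`). By compactness it is attained, by
concatenation the optimal solutions for different points are consistent, and together they form a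
solution `u` with `u(τ(p)) = p` (`exists_apply_reachTime_eq`). Every other solution `v` on the range
satisfies `τ(v(t)) ≤ τ(v(s)) + (t - s)`, so that `v = u ∘ z` with the `1`-Lipschitz map `z = τ ∘ v`,
continued by a constant if `v` leaves the range (`succeeds_of_apply_reachTime_eq`). The properties
of minimal solutions are consequences of the representation `v = u ∘ z` with `z(t) ≤ t`.
-/

noncomputable section

namespace LambdaSemiflow

section

/-! ### The metric derivative of a locally absolutely continuous curve -/

lemma absolutelyContinuousOnInterval_of_dist_le {X Y : Type*} [PseudoMetricSpace X]
    [PseudoMetricSpace Y] {f : ℝ → X} {F : ℝ → Y} {a b : ℝ}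
    (hF : AbsolutelyContinuousOnInterval F a b)
    (h : ∀ x ∈ uIcc a b, ∀ y ∈ uIcc a b, dist (f x) (f y) ≤ dist (F x) (F y)) :
    AbsolutelyContinuousOnInterval f a b := by
  rw [absolutelyContinuousOnInterval_iff] at hF ⊢
  intro ε hε
  obtain ⟨δ, hδ, H⟩ := hF ε hε
  refine ⟨δ, hδ, fun E hE hlt => lt_of_le_of_lt (Finset.sum_le_sum fun i hi => ?_) (H E hE hlt)⟩
  exact h _ (hE.1 i hi).1 _ (hE.1 i hi).2

/-- The Cauchy–Schwarz inequality on an interval. -/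
lemma sq_lintegral_le {f : ℝ → ℝ≥0∞} {s t : ℝ} (hf : AEMeasurable f (volume.restrict (Ioc s t))) :
    (∫⁻ r in Ioc s t, f r) ^ 2 ≤ ENNReal.ofReal (t - s) * ∫⁻ r in Ioc s t, f r ^ 2 := by
  have h := ENNReal.lintegral_mul_le_Lp_mul_Lq (volume.restrict (Ioc s t))
    Real.HolderConjugate.two_two (f := fun _ => 1) (g := f) aemeasurable_const hf
  simp only [Pi.mul_apply, one_mul, ENNReal.one_rpow, lintegral_const, Measure.restrict_apply_univ,
    Real.volume_Ioc] at h
  calc (∫⁻ r in Ioc s t, f r) ^ 2 ≤ _ := pow_le_pow_left₀ (by positivity) h 2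
    _ = _ := by
      rw [mul_pow]
      simp only [← ENNReal.rpow_natCast, ← ENNReal.rpow_mul]
      norm_num

/-- Difference quotients of a curve at an interior time `x` may be computed along real times. -/
lemma tendsto_coe_nhdsNE_toNNReal {x : ℝ} (hx : 0 < x) :
    Tendsto (fun σ : ℝ≥0 => (σ : ℝ)) (𝓝[≠] x.toNNReal) (𝓝[≠] x) := by
  have hxx : ((x.toNNReal : ℝ≥0) : ℝ) = x := Real.coe_toNNReal _ hx.le
  refine tendsto_nhdsWithin_iff.2 ⟨?_, ?_⟩
  · have := NNReal.continuous_coe.tendsto x.toNNReal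
    rw [hxx] at this
    exact this.mono_left nhdsWithin_le_nhds
  · filter_upwards [self_mem_nhdsWithin] with σ hσ h
    exact hσ (by rw [mem_singleton_iff] at h ⊢; rw [← h, Real.toNNReal_coe])

lemma neBot_nhdsNE (x : ℝ≥0) : NeBot (𝓝[≠] x) :=
  NeBot.mono (f := 𝓝[>] x) inferInstance (nhdsWithin_mono _ fun y (hy : x < y) => ne_of_gt hy)

variable {S : Type*} [MetricSpace S]

lemma ofReal_abs_deriv_dist_le_metricDeriv (u : ℝ≥0 → S) (p : S) {x : ℝ} (hx : 0 < x)
    (hd : DifferentiableAt ℝ (fun y : ℝ => dist p (u y.toNNReal)) x) :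
    ENNReal.ofReal |deriv (fun y : ℝ => dist p (u y.toNNReal)) x| ≤ metricDeriv u x.toNNReal := by
  set f : ℝ → ℝ := fun y => dist p (u y.toNNReal) with hf
  have hxx : ((x.toNNReal : ℝ≥0) : ℝ) = x := Real.coe_toNNReal _ hx.le
  have hto := tendsto_coe_nhdsNE_toNNReal hx
  have h1 : Tendsto (fun σ : ℝ≥0 => ENNReal.ofReal |slope f x σ|) (𝓝[≠] x.toNNReal)
      (𝓝 (ENNReal.ofReal |deriv f x|)) :=
    ENNReal.tendsto_ofReal ((hd.hasDerivAt.tendsto_slope.comp hto).abs)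
  have := neBot_nhdsNE x.toNNReal
  rw [← h1.limsup_eq]
  refine limsup_le_limsup ?_
  filter_upwards [self_mem_nhdsWithin] with σ hσ
  have hne : (σ : ℝ) ≠ x := fun h => hσ (by rw [mem_singleton_iff, ← h, Real.toNNReal_coe])
  have hpos : 0 < |(σ : ℝ) - x| := abs_pos.2 (sub_ne_zero.2 hne)
  have hd' : dist σ x.toNNReal = |(σ : ℝ) - x| := by rw [NNReal.dist_eq, hxx]
  rw [edist_dist, edist_dist, hd', ← ENNReal.ofReal_div_of_pos hpos]
  refine ENNReal.ofReal_le_ofReal ?_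
  rw [slope_def_field, abs_div]
  gcongr
  simp only [hf, Real.toNNReal_coe]
  rw [dist_comm (u σ)]
  have := abs_dist_sub_le (u σ) (u x.toNNReal) p
  rwa [dist_comm (u σ) p, dist_comm (u x.toNNReal) p, dist_comm (u σ)] at this

/-- The Cauchy–Schwarz estimate `d(u(s), u(t))² ≤ (t - s) ∫_s^t |u'|²`. The distance from `u s` is
an absolutely continuous function along `u`, with derivative bounded by `|u'|`; no measurability of
`|u'|` is needed. -/
lemma IsLocAbsContinuous.sq_dist_le {u : ℝ≥0 → S} (hu : IsLocAbsContinuous u) {s t : ℝ≥0}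
    (hst : s ≤ t) :
    ENNReal.ofReal (dist (u s) (u t) ^ 2) ≤
      ENNReal.ofReal (t - s) * ∫⁻ r in Ioc (s : ℝ) t, metricDeriv u r.toNNReal ^ 2 := by
  obtain ⟨m, hm, hmu⟩ := hu
  have hst' : (s : ℝ) ≤ t := hst
  set f : ℝ → ℝ := fun y => dist (u s) (u y.toNNReal) with hf
  have hint : ∀ a b : ℝ, 0 ≤ a → 0 ≤ b → IntervalIntegrable m volume a b := fun a b ha hb => by
    rw [intervalIntegrable_iff]
    refine (hm.integrableOn_compact_subset (t := uIcc a b) ?_ isCompact_uIcc).mono_set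
      uIoc_subset_uIcc
    exact fun z hz => le_trans (le_min ha hb) hz.1
  have hac : AbsolutelyContinuousOnInterval f s t := by
    refine absolutelyContinuousOnInterval_of_dist_le
      ((hint s t s.coe_nonneg t.coe_nonneg).absolutelyContinuousOnInterval_intervalIntegral
        left_mem_uIcc) ?_
    have key : ∀ x ∈ uIcc (s : ℝ) t, ∀ y ∈ uIcc (s : ℝ) t, x ≤ y →
        dist (f x) (f y) ≤ dist (∫ r in (s : ℝ)..x, m r) (∫ r in (s : ℝ)..y, m r) := by
      intro x hx y hy hxy
      rw [uIcc_of_le hst'] at hx hy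
      have hx0 : 0 ≤ x := s.coe_nonneg.trans hx.1
      have hy0 : 0 ≤ y := s.coe_nonneg.trans hy.1
      rw [dist_comm (∫ r in (s : ℝ)..x, m r), Real.dist_eq (∫ r in (s : ℝ)..y, m r),
        intervalIntegral.integral_interval_sub_left (hint _ _ s.coe_nonneg hy0)
          (hint (s : ℝ) x s.coe_nonneg hx0)]
      have h1 := hmu x.toNNReal y.toNNReal (Real.toNNReal_le_toNNReal hxy)
      rw [Real.coe_toNNReal _ hx0, Real.coe_toNNReal _ hy0] at h1
      exact (dist_dist_dist_le_right _ _ _).trans (h1.trans (le_abs_self _))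
    intro x hx y hy
    rcases le_total x y with h | h
    · exact key x hx y hy h
    · rw [dist_comm, dist_comm (∫ r in (s : ℝ)..x, m r)]; exact key y hy x hx h
  have hle : ENNReal.ofReal (dist (u s) (u t)) ≤ ∫⁻ r in Ioc (s : ℝ) t, ‖deriv f r‖ₑ := by
    have h1 : dist (u s) (u t) = ∫ r in (s : ℝ)..t, deriv f r := by
      rw [hac.integral_deriv_eq_sub]; simp [hf]
    rw [h1, intervalIntegral.integral_of_le hst']
    refine le_trans (ENNReal.ofReal_le_ofReal (Real.le_norm_self _)) ?_
    rw [ofReal_norm]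
    exact enorm_integral_le_lintegral_enorm _
  have hle2 : ∫⁻ r in Ioc (s : ℝ) t, ‖deriv f r‖ₑ ^ 2 ≤
      ∫⁻ r in Ioc (s : ℝ) t, metricDeriv u r.toNNReal ^ 2 := by
    refine lintegral_mono_ae ?_
    rw [ae_restrict_iff' measurableSet_Ioc]
    filter_upwards [hac.ae_differentiableAt] with x hx hxI
    have h2 := ofReal_abs_deriv_dist_le_metricDeriv u (u s) (lt_of_le_of_lt s.coe_nonneg hxI.1)
      (hx (by rw [uIcc_of_le hst']; exact Ioc_subset_Icc_self hxI))
    rw [← Real.norm_eq_abs, ofReal_norm] at h2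
    exact pow_le_pow_left₀ (by positivity) h2 2
  rw [ENNReal.ofReal_pow dist_nonneg]
  calc _ ≤ (∫⁻ r in Ioc (s : ℝ) t, ‖deriv f r‖ₑ) ^ 2 := pow_le_pow_left₀ (by positivity) hle 2
    _ ≤ _ := sq_lintegral_le ((measurable_deriv f).enorm.aemeasurable)
    _ ≤ _ := by gcongr

end

section

/-! ### Curves whose displacement is controlled by a monotone function -/

/-- The increments of a monotone function over disjoint intervals are the lengths of disjoint
intervals. -/
lemma sum_dist_le_of_monotone {h : ℝ → ℝ} (hh : Monotone h) {a b : ℝ} (hab : a ≤ b)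
    {E : ℕ × (ℕ → ℝ × ℝ)} (hE : E ∈ AbsolutelyContinuousOnInterval.disjWithin a b) :
    ∑ i ∈ Finset.range E.1, dist (h (E.2 i).1) (h (E.2 i).2) ≤ h b - h a := by
  obtain ⟨hE1, hE2⟩ := hE
  have hdisj : Set.PairwiseDisjoint (Finset.range E.1 : Set ℕ)
      (fun i => uIoc (h (E.2 i).1) (h (E.2 i).2)) := by
    intro i hi j hj hij
    have := hE2 hi hj hij
    simp only [Function.onFun, uIoc, Set.Ioc_disjoint_Ioc] at this ⊢
    simpa only [hh.map_min, hh.map_max] using hh this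
  have h1 := measure_biUnion_finset (μ := (volume : Measure ℝ)) hdisj
    (fun i _ => measurableSet_uIoc)
  have h2 : (⋃ i ∈ Finset.range E.1, uIoc (h (E.2 i).1) (h (E.2 i).2)) ⊆ Ioc (h a) (h b) := by
    refine iUnion₂_subset fun i hi => ?_
    have h3 := hE1 i hi
    rw [uIcc_of_le hab] at h3
    exact Ioc_subset_Ioc (le_min (hh h3.1.1) (hh h3.2.1)) (max_le (hh h3.1.2) (hh h3.2.2))
  have h3 := measure_mono (μ := (volume : Measure ℝ)) h2
  rw [h1] at h3
  simp only [Real.volume_uIoc, Real.volume_Ioc] at h3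
  rw [← ENNReal.ofReal_sum_of_nonneg (fun i _ => abs_nonneg _),
    ENNReal.ofReal_le_ofReal_iff (sub_nonneg.2 (hh hab))] at h3
  refine le_trans (le_of_eq (Finset.sum_congr rfl fun i _ => ?_)) h3
  rw [dist_comm, Real.dist_eq]

/-- Over disjoint intervals of total length `δ` the sum of the increments of `f` is at most
`√δ √(h b - h a)`, by the Cauchy–Schwarz inequality. The function `h` need not be continuous. -/
lemma absolutelyContinuousOnInterval_of_sq_dist_le {X : Type*} [PseudoMetricSpace X] {f : ℝ → X}
    {h : ℝ → ℝ} (hh : Monotone h) {a b : ℝ} (hab : a ≤ b)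
    (hf : ∀ x ∈ Icc a b, ∀ y ∈ Icc a b, dist (f x) (f y) ^ 2 ≤ dist x y * dist (h x) (h y)) :
    AbsolutelyContinuousOnInterval f a b := by
  rw [absolutelyContinuousOnInterval_iff]
  intro ε hε
  have hc : 0 ≤ h b - h a := sub_nonneg.2 (hh hab)
  refine ⟨ε ^ 2 / (h b - h a + 1), by positivity, fun E hE hlt => ?_⟩
  have h1 : ∑ i ∈ Finset.range E.1, dist (f (E.2 i).1) (f (E.2 i).2) ≤
      ∑ i ∈ Finset.range E.1,
        √(dist (E.2 i).1 (E.2 i).2) * √(dist (h (E.2 i).1) (h (E.2 i).2)) := by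
    refine Finset.sum_le_sum fun i hi => ?_
    rw [← Real.sqrt_mul dist_nonneg]
    have h3 := hE.1 i hi
    rw [uIcc_of_le hab] at h3
    exact Real.le_sqrt_of_sq_le (hf _ h3.1 _ h3.2)
  have h2 := Real.sum_sqrt_mul_sqrt_le (Finset.range E.1)
    (f := fun i => dist (E.2 i).1 (E.2 i).2) (g := fun i => dist (h (E.2 i).1) (h (E.2 i).2))
    (fun i => dist_nonneg) (fun i => dist_nonneg)
  have h3 := sum_dist_le_of_monotone hh hab hE
  have h0 : 0 ≤ ∑ i ∈ Finset.range E.1, dist (E.2 i).1 (E.2 i).2 :=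
    Finset.sum_nonneg fun i _ => dist_nonneg
  refine lt_of_le_of_lt (h1.trans h2) ?_
  rw [← Real.sqrt_mul h0]
  refine (Real.sqrt_lt' hε).2 ?_
  calc _ ≤ (∑ i ∈ Finset.range E.1, dist (E.2 i).1 (E.2 i).2) * (h b - h a + 1) := by
        gcongr; linarith
    _ < ε ^ 2 / (h b - h a + 1) * (h b - h a + 1) := by gcongr
    _ = ε ^ 2 := by field_simp

variable {S : Type*} [MetricSpace S]

section Controlled

variable {u : ℝ≥0 → S} {h : ℝ → ℝ}

lemma sq_dist_le_mul_dist (hh : Monotone h)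
    (hu : ∀ s t : ℝ≥0, s ≤ t → dist (u s) (u t) ^ 2 ≤ (t - s) * (h t - h s)) (s t : ℝ≥0) :
    dist (u s) (u t) ^ 2 ≤ dist (s : ℝ) t * dist (h s) (h t) := by
  wlog hst : s ≤ t generalizing s t
  · have := this t s (le_of_not_ge hst)
    rwa [dist_comm (u s), dist_comm (s : ℝ), dist_comm (h s)]
  have hst' : (s : ℝ) ≤ t := hst
  rw [dist_comm (s : ℝ), dist_comm (h s), Real.dist_eq, Real.dist_eq,
    abs_of_nonneg (sub_nonneg.2 hst'), abs_of_nonneg (sub_nonneg.2 (hh hst'))]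
  exact hu s t hst

lemma metricDeriv_le_sqrt_deriv (hh : Monotone h)
    (hu : ∀ s t : ℝ≥0, s ≤ t → dist (u s) (u t) ^ 2 ≤ (t - s) * (h t - h s))
    {x : ℝ} (hx : 0 < x) (hd : DifferentiableAt ℝ h x) :
    metricDeriv u x.toNNReal ≤ ENNReal.ofReal (√(deriv h x)) := by
  have hxx : ((x.toNNReal : ℝ≥0) : ℝ) = x := Real.coe_toNNReal _ hx.le
  have hto := tendsto_coe_nhdsNE_toNNReal hx
  have h1 : Tendsto (fun σ : ℝ≥0 => ENNReal.ofReal (√(slope h x σ))) (𝓝[≠] x.toNNReal)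
      (𝓝 (ENNReal.ofReal (√(deriv h x)))) :=
    ENNReal.tendsto_ofReal ((hd.hasDerivAt.tendsto_slope.comp hto).sqrt)
  have := neBot_nhdsNE x.toNNReal
  rw [← h1.limsup_eq]
  refine limsup_le_limsup ?_
  filter_upwards [self_mem_nhdsWithin] with σ hσ
  have hne : (σ : ℝ) ≠ x := fun h => hσ (by rw [mem_singleton_iff, ← h, Real.toNNReal_coe])
  have hpos : 0 < |(σ : ℝ) - x| := abs_pos.2 (sub_ne_zero.2 hne)
  have hd' : dist σ x.toNNReal = |(σ : ℝ) - x| := by rw [NNReal.dist_eq, hxx]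
  rw [edist_dist, edist_dist, hd', ← ENNReal.ofReal_div_of_pos hpos]
  refine ENNReal.ofReal_le_ofReal (Real.le_sqrt_of_sq_le ?_)
  have h2 := sq_dist_le_mul_dist hh hu σ x.toNNReal
  rw [hxx, Real.dist_eq, Real.dist_eq] at h2
  have h3 : slope h x σ = |h σ - h x| / |(σ : ℝ) - x| := by
    rw [← abs_div, ← slope_def_field, abs_of_nonneg]
    exact (hh.monotoneOn univ).slope_nonneg trivial trivial
  rw [h3, div_pow, div_le_div_iff₀ (by positivity) hpos]
  calc _ ≤ |(σ : ℝ) - x| * |h σ - h x| * |(σ : ℝ) - x| := by gcongr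
    _ = _ := by ring

lemma locallyIntegrable_sqrt_deriv (hh : Monotone h) :
    LocallyIntegrable (fun x => √(deriv h x)) := by
  rw [locallyIntegrable_iff]
  intro K hK
  obtain ⟨a, b, hKab⟩ : ∃ a b : ℝ, K ⊆ Icc a b := by
    obtain ⟨r, hr⟩ := hK.isBounded.subset_closedBall 0
    exact ⟨0 - r, 0 + r, by rwa [← Real.closedBall_eq_Icc]⟩
  rcases le_or_gt a b with hab | hab
  · have h1 : IntegrableOn (deriv h) (Icc a b) :=
      (intervalIntegrable_iff_integrableOn_Icc_of_le hab).1
        (MonotoneOn.intervalIntegrable_deriv (hh.monotoneOn _))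
    have h2 : IntegrableOn (fun x => 1 + ‖deriv h x‖) (Icc a b) :=
      (integrableOn_const (by simp)).add h1.norm
    refine IntegrableOn.mono_set (Integrable.mono' h2 ?_ (Eventually.of_forall fun x => ?_)) hKab
    · exact (Real.continuous_sqrt.measurable.comp (measurable_deriv h)).aestronglyMeasurable
    · rw [Real.norm_of_nonneg (Real.sqrt_nonneg _), Real.sqrt_le_left (by positivity)]
      have := Real.le_norm_self (deriv h x)
      nlinarith [norm_nonneg (deriv h x)]
  · rw [Icc_eq_empty (not_le.2 hab), subset_empty_iff] at hKab
    simp [hKab]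

/-- The density in the definition of absolute continuity may be taken to be `√h'`: the distance from
`u s` is absolutely continuous along `u`, with derivative at most `|u'| ≤ √h'`. -/
lemma IsLocAbsContinuous.of_sq_dist_le (hh : Monotone h)
    (hu : ∀ s t : ℝ≥0, s ≤ t → dist (u s) (u t) ^ 2 ≤ (t - s) * (h t - h s)) :
    IsLocAbsContinuous u := by
  refine ⟨fun x => √(deriv h x), (locallyIntegrable_sqrt_deriv hh).locallyIntegrableOn _, ?_⟩
  intro s t hst
  have hst' : (s : ℝ) ≤ t := hst
  set f : ℝ → ℝ := fun y => dist (u s) (u y.toNNReal) with hf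
  have hac : AbsolutelyContinuousOnInterval f s t := by
    refine absolutelyContinuousOnInterval_of_sq_dist_le hh hst' fun x hx y hy => ?_
    have h1 := sq_dist_le_mul_dist hh hu x.toNNReal y.toNNReal
    rw [Real.coe_toNNReal _ (s.coe_nonneg.trans hx.1),
      Real.coe_toNNReal _ (s.coe_nonneg.trans hy.1)] at h1
    refine le_trans ?_ h1
    gcongr
    exact dist_dist_dist_le_right _ _ _
  have h1 : dist (u s) (u t) = ∫ r in (s : ℝ)..t, deriv f r := by
    rw [hac.integral_deriv_eq_sub]; simp [hf]
  rw [h1, intervalIntegral.integral_of_le hst', intervalIntegral.integral_of_le hst']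
  refine setIntegral_mono_ae_restrict ?_ ?_ ?_
  · exact (intervalIntegrable_iff_integrableOn_Ioc_of_le hst').1 hac.intervalIntegrable_deriv
  · exact ((locallyIntegrable_sqrt_deriv hh).integrableOn_isCompact
      isCompact_Icc).mono_set Ioc_subset_Icc_self
  · rw [EventuallyLE, ae_restrict_iff' measurableSet_Ioc]
    filter_upwards [hac.ae_differentiableAt, hh.ae_differentiableAt] with x hx hxh hxI
    have hx0 : 0 < x := lt_of_le_of_lt s.coe_nonneg hxI.1
    have h2 := (ofReal_abs_deriv_dist_le_metricDeriv u (u s) hx0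
      (hx (by rw [uIcc_of_le hst']; exact Ioc_subset_Icc_self hxI))).trans
      (metricDeriv_le_sqrt_deriv hh hu hx0 hxh)
    exact (le_abs_self _).trans ((ENNReal.ofReal_le_ofReal_iff (Real.sqrt_nonneg _)).1 h2)

lemma lintegral_sq_metricDeriv_le (hh : Monotone h)
    (hu : ∀ s t : ℝ≥0, s ≤ t → dist (u s) (u t) ^ 2 ≤ (t - s) * (h t - h s))
    {s t : ℝ≥0} (hst : s ≤ t) :
    ∫⁻ r in Ioc (s : ℝ) t, metricDeriv u r.toNNReal ^ 2 ≤ ENNReal.ofReal (h t - h s) := by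
  have hst' : (s : ℝ) ≤ t := hst
  have hnn : ∀ x, 0 ≤ deriv h x := fun x => hh.deriv_nonneg
  have hint : IntervalIntegrable (deriv h) volume s t :=
    MonotoneOn.intervalIntegrable_deriv (hh.monotoneOn _)
  calc ∫⁻ r in Ioc (s : ℝ) t, metricDeriv u r.toNNReal ^ 2
      ≤ ∫⁻ r in Ioc (s : ℝ) t, ENNReal.ofReal (deriv h r) := by
        refine lintegral_mono_ae ?_
        rw [ae_restrict_iff' measurableSet_Ioc]
        filter_upwards [hh.ae_differentiableAt] with x hxh hxI
        have h2 := metricDeriv_le_sqrt_deriv hh hu (lt_of_le_of_lt s.coe_nonneg hxI.1) hxh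
        refine (pow_le_pow_left₀ (by positivity) h2 2).trans ?_
        rw [← ENNReal.ofReal_pow (Real.sqrt_nonneg _), Real.sq_sqrt (hnn x)]
    _ = ENNReal.ofReal (∫ r in (s : ℝ)..t, deriv h r) := by
        rw [intervalIntegral.integral_of_le hst', ofReal_integral_eq_lintegral_ofReal]
        · exact (intervalIntegrable_iff_integrableOn_Ioc_of_le hst').1 hint
        · exact Eventually.of_forall hnn
    _ ≤ _ := by
        refine ENNReal.ofReal_le_ofReal ?_
        have := MonotoneOn.intervalIntegral_deriv_mem_uIcc (hh.monotoneOn (uIcc (s : ℝ) t))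
        rw [uIcc_of_le (sub_nonneg.2 (hh hst'))] at this
        exact this.2

end Controlled

end

section

/-! ### The energy dissipation inequality without derivatives -/

variable {S : Type*}

/-- The real number `φ(u(t))`; meaningful where `φ(u(t))` is finite. -/
def energy (φ : S → EReal) (u : ℝ≥0 → S) (t : ℝ≥0) : ℝ := (φ (u t)).toReal

/-- `∫_s^t g²(u(r)) dr`. -/
def slopeCost (g : S → ℝ≥0∞) (u : ℝ≥0 → S) (s t : ℝ≥0) : ℝ≥0∞ :=
  ∫⁻ r in Ioc (s : ℝ) t, g (u r.toNNReal) ^ 2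

lemma slopeCost_self (g : S → ℝ≥0∞) (u : ℝ≥0 → S) (s : ℝ≥0) : slopeCost g u s s = 0 := by
  simp [slopeCost]

lemma slopeCost_add (g : S → ℝ≥0∞) (u : ℝ≥0 → S) {s a t : ℝ≥0} (hsa : s ≤ a) (hat : a ≤ t) :
    slopeCost g u s t = slopeCost g u s a + slopeCost g u a t := by
  have h1 : (s : ℝ) ≤ a := hsa
  have h2 : (a : ℝ) ≤ t := hat
  rw [slopeCost, ← Ioc_union_Ioc_eq_Ioc h1 h2,
    lintegral_union measurableSet_Ioc (Ioc_disjoint_Ioc_of_le le_rfl)]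
  rfl

lemma slopeCost_shift (g : S → ℝ≥0∞) {u v : ℝ≥0 → S} {s t τ : ℝ≥0}
    (h : ∀ r ∈ Icc s t, v r = u (r + τ)) :
    slopeCost g v s t = slopeCost g u (s + τ) (t + τ) := by
  have h1 := (measurePreserving_add_right (volume : Measure ℝ) τ).setLIntegral_comp_preimage_emb
    (measurableEmbedding_addRight (τ : ℝ)) (fun r => g (u r.toNNReal) ^ 2)
    (Ioc ((s + τ : ℝ≥0) : ℝ) ((t + τ : ℝ≥0) : ℝ))
  rw [slopeCost, slopeCost, ← h1]
  have h2 : (fun x : ℝ => x + τ) ⁻¹' Ioc ((s + τ : ℝ≥0) : ℝ) ((t + τ : ℝ≥0) : ℝ) =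
      Ioc (s : ℝ) t := by
    ext x; simp
  rw [h2]
  refine setLIntegral_congr_fun measurableSet_Ioc fun r hr => ?_
  have hr0 : 0 ≤ r := s.coe_nonneg.trans hr.1.le
  rw [h r.toNNReal ⟨NNReal.le_toNNReal_of_coe_le hr.1.le, Real.toNNReal_le_iff_le_coe.2 hr.2⟩,
    Real.toNNReal_add hr0 τ.coe_nonneg, Real.toNNReal_coe]

lemma sub_eq_coe_energy_sub {φ : S → EReal} {u : ℝ≥0 → S} (hφ_bot : ∀ x, φ x ≠ ⊥)
    (hu : ∀ t, φ (u t) ≠ ⊤) (s t : ℝ≥0) :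
    φ (u s) - φ (u t) = ((energy φ u s - energy φ u t : ℝ) : EReal) := by
  rw [EReal.coe_sub, energy, energy, EReal.coe_toReal (hu s) (hφ_bot _),
    EReal.coe_toReal (hu t) (hφ_bot _)]

variable [MetricSpace S]

/-- The part of twice the energy drop on `[s, t]` which is not needed for the displacement
`d²(u(s), u(t)) / (t - s)`. -/
def slack (φ : S → EReal) (u : ℝ≥0 → S) (s t : ℝ≥0) : ℝ :=
  2 * (energy φ u s - energy φ u t) - dist (u s) (u t) ^ 2 / ((t : ℝ) - s)

/-- On `[s, t]` the energy drop pays for the slope and for the displacement between the end points: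
`∫_s^t g² + d²(u(s), u(t)) / (t - s) ≤ 2 (φ(u(s)) - φ(u(t)))`. -/
def DissipatesOn (φ : S → EReal) (g : S → ℝ≥0∞) (u : ℝ≥0 → S) (s t : ℝ≥0) : Prop :=
  0 ≤ slack φ u s t ∧ slopeCost g u s t ≤ ENNReal.ofReal (slack φ u s t)

/-- The derivative-free form of the energy dissipation inequality. -/
structure IsDissipative (φ : S → EReal) (g : S → ℝ≥0∞) (u : ℝ≥0 → S) : Prop where
  ne_top : ∀ t, φ (u t) ≠ ⊤
  dissipatesOn : ∀ s t : ℝ≥0, s ≤ t → DissipatesOn φ g u s t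

variable {φ : S → EReal} {g : S → ℝ≥0∞} {u v : ℝ≥0 → S}

lemma dissipatesOn_self (s : ℝ≥0) : DissipatesOn φ g u s s := by
  simp [DissipatesOn, slack, slopeCost_self]

lemma sq_add_div_add_le {a b x y : ℝ} (hx : 0 < x) (hy : 0 < y) :
    (a + b) ^ 2 / (x + y) ≤ a ^ 2 / x + b ^ 2 / y := by
  rw [div_add_div _ _ hx.ne' hy.ne', div_le_div_iff₀ (by positivity) (by positivity)]
  nlinarith [sq_nonneg (a * y - b * x), mul_pos hx hy]

/-- The inequality on adjacent intervals adds up, because `(d, h) ↦ d² / h` is subadditive. -/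
lemma DissipatesOn.trans {s a t : ℝ≥0} (hsa : s ≤ a) (hat : a ≤ t)
    (h1 : DissipatesOn φ g u s a) (h2 : DissipatesOn φ g u a t) : DissipatesOn φ g u s t := by
  rcases hsa.eq_or_lt with rfl | hsa'
  · exact h2
  rcases hat.eq_or_lt with rfl | hat'
  · exact h1
  have hs : slack φ u s a + slack φ u a t ≤ slack φ u s t := by
    have e1 : (0 : ℝ) < a - s := sub_pos.2 hsa'
    have e2 : (0 : ℝ) < t - a := sub_pos.2 hat'
    have h3 := sq_add_div_add_le (a := dist (u s) (u a)) (b := dist (u a) (u t)) e1 e2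
    have h4 : dist (u s) (u t) ^ 2 / ((t : ℝ) - s) ≤
        (dist (u s) (u a) + dist (u a) (u t)) ^ 2 / ((a : ℝ) - s + (t - a)) := by
      have : (a : ℝ) - s + (t - a) = t - s := by ring
      rw [this]
      have : (0 : ℝ) ≤ t - s := by linarith
      gcongr
      exact dist_triangle _ _ _
    simp only [slack]
    linarith
  refine ⟨(add_nonneg h1.1 h2.1).trans hs, ?_⟩
  rw [slopeCost_add g u hsa hat]
  calc _ ≤ _ := add_le_add h1.2 h2.2
    _ = _ := (ENNReal.ofReal_add h1.1 h2.1).symm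
    _ ≤ _ := ENNReal.ofReal_le_ofReal hs

lemma dissipatesOn_shift {s t τ : ℝ≥0} (hst : s ≤ t) (h : ∀ r ∈ Icc s t, v r = u (r + τ)) :
    DissipatesOn φ g v s t ↔ DissipatesOn φ g u (s + τ) (t + τ) := by
  have h1 : slack φ v s t = slack φ u (s + τ) (t + τ) := by
    simp only [slack, energy]
    rw [h s ⟨le_rfl, hst⟩, h t ⟨hst, le_rfl⟩]
    push_cast
    congr 2
    ring
  rw [DissipatesOn, DissipatesOn, h1, slopeCost_shift g h]

lemma dissipatesOn_congr {s t : ℝ≥0} (hst : s ≤ t) (h : ∀ r ∈ Icc s t, v r = u r) :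
    DissipatesOn φ g v s t ↔ DissipatesOn φ g u s t := by
  simpa using dissipatesOn_shift (φ := φ) (g := g) (τ := 0) hst (by simpa using h)

lemma DissipatesOn.sq_dist_le {s t : ℝ≥0} (hst : s ≤ t) (h : DissipatesOn φ g u s t) :
    dist (u s) (u t) ^ 2 ≤ 2 * (t - s) * (energy φ u s - energy φ u t) := by
  rcases hst.eq_or_lt with rfl | hst'
  · simp
  have e : (0 : ℝ) < t - s := sub_pos.2 hst'
  have h1 := h.1
  rw [slack, sub_nonneg, div_le_iff₀ e] at h1
  linarith

lemma DissipatesOn.energy_le {s t : ℝ≥0} (hst : s ≤ t) (h : DissipatesOn φ g u s t) :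
    energy φ u t ≤ energy φ u s := by
  have h1 := h.1
  have : 0 ≤ dist (u s) (u t) ^ 2 / ((t : ℝ) - s) :=
    div_nonneg (sq_nonneg _) (sub_nonneg.2 hst)
  rw [slack] at h1
  linarith

namespace IsDissipative

lemma energy_antitone (h : IsDissipative φ g u) : Antitone (energy φ u) :=
  fun s t hst => (h.dissipatesOn s t hst).energy_le hst

lemma sq_dist_le (h : IsDissipative φ g u) {s t : ℝ≥0} (hst : s ≤ t) :
    dist (u s) (u t) ^ 2 ≤ 2 * (t - s) * (energy φ u s - energy φ u t) :=
  (h.dissipatesOn s t hst).sq_dist_le hst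

/-- A solution is Hölder continuous of order `1/2` on `[0, T]`, with a constant given by its energy
drop. -/
lemma sq_dist_le_of_le (h : IsDissipative φ g u) {s t T : ℝ≥0} (hs : s ≤ T) (ht : t ≤ T) :
    dist (u s) (u t) ^ 2 ≤ 2 * dist s t * (energy φ u 0 - energy φ u T) := by
  wlog hst : s ≤ t generalizing s t
  · have := this ht hs (le_of_not_ge hst)
    rwa [dist_comm (u s), dist_comm s]
  have e : (0 : ℝ) ≤ t - s := sub_nonneg.2 hst
  have h1 : dist s t = (t : ℝ) - s := by rw [dist_comm, NNReal.dist_eq, abs_of_nonneg e]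
  rw [h1]
  refine (h.sq_dist_le hst).trans ?_
  have := h.energy_antitone (zero_le : 0 ≤ s)
  have := h.energy_antitone ht
  gcongr

lemma continuous (h : IsDissipative φ g u) : Continuous u := by
  rw [continuous_iff_continuousAt]
  intro a
  rw [ContinuousAt, tendsto_iff_dist_tendsto_zero]
  have h1 : Tendsto (fun t => √(2 * dist t a * (energy φ u 0 - energy φ u (a + 1)))) (𝓝 a)
      (𝓝 0) := by
    have : Continuous fun t : ℝ≥0 => √(2 * dist t a * (energy φ u 0 - energy φ u (a + 1))) := by
      fun_prop
    simpa using this.tendsto a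
  refine squeeze_zero' (Eventually.of_forall fun _ => dist_nonneg) ?_ h1
  filter_upwards [Iic_mem_nhds (lt_add_one a)] with t ht
  exact Real.le_sqrt_of_sq_le (h.sq_dist_le_of_le ht (lt_add_one a).le)

lemma eq_of_energy_eq (h : IsDissipative φ g u) {s t : ℝ≥0} (he : energy φ u s = energy φ u t) :
    u s = u t := by
  wlog hst : s ≤ t generalizing s t
  · exact (this he.symm (le_of_not_ge hst)).symm
  have h1 := h.sq_dist_le hst
  rw [he, sub_self, mul_zero] at h1
  exact dist_eq_zero.1 (by nlinarith [dist_nonneg (x := u s) (y := u t)])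

lemma eq_of_mem_Icc (h : IsDissipative φ g u) {s t r : ℝ≥0} (he : u s = u t) (hr : r ∈ Icc s t) :
    u r = u t := by
  refine h.eq_of_energy_eq (le_antisymm ?_ (h.energy_antitone hr.2))
  have : energy φ u t = energy φ u s := by simp only [energy, he]
  rw [this]
  exact h.energy_antitone hr.1

lemma slopeCost_ne_top (h : IsDissipative φ g u) {s t : ℝ≥0} (hst : s ≤ t) :
    slopeCost g u s t ≠ ⊤ :=
  ((h.dissipatesOn s t hst).2.trans_lt ENNReal.ofReal_lt_top).ne

lemma translation (h : IsDissipative φ g u) (τ : ℝ≥0) : IsDissipative φ g (fun t => u (t + τ)) :=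
  ⟨fun _ => h.ne_top _, fun _ _ hst =>
    (dissipatesOn_shift hst fun _ _ => rfl).2 (h.dissipatesOn _ _ (add_le_add_left hst τ))⟩

lemma concatenation (hu : IsDissipative φ g u) (hv : IsDissipative φ g v) {a : ℝ≥0}
    (ha : v 0 = u a) : IsDissipative φ g (fun t => if t ≤ a then u t else v (t - a)) := by
  set w : ℝ≥0 → S := fun t => if t ≤ a then u t else v (t - a) with hw
  have h1 : ∀ r, r ≤ a → w r = u r := fun r hr => if_pos hr
  have h2 : ∀ r, w (r + a) = v r := fun r => by
    by_cases hr : r + a ≤ a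
    · have : r = 0 := by simpa using hr
      subst this
      rw [h1 _ hr, ha, zero_add]
    · simp [hw, hr]
  have d1 : ∀ s t, s ≤ t → t ≤ a → DissipatesOn φ g w s t := fun s t hst hta =>
    (dissipatesOn_congr hst fun r hr => h1 r (hr.2.trans hta)).2 (hu.dissipatesOn s t hst)
  have d2 : ∀ s t, s ≤ t → a ≤ s → DissipatesOn φ g w s t := by
    intro s t hst has
    have := (dissipatesOn_shift (φ := φ) (g := g) (u := w) (v := v) (s := s - a) (t := t - a)
      (τ := a) (tsub_le_tsub_right hst a) fun r _ => (h2 r).symm).1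
      (hv.dissipatesOn _ _ (tsub_le_tsub_right hst a))
    rwa [tsub_add_cancel_of_le has, tsub_add_cancel_of_le (has.trans hst)] at this
  refine ⟨fun t => ?_, fun s t hst => ?_⟩
  · rcases le_total t a with h | h
    · rw [h1 t h]; exact hu.ne_top t
    · rw [← tsub_add_cancel_of_le h, h2]; exact hv.ne_top _
  · rcases le_total t a with hta | hat
    · exact d1 s t hst hta
    rcases le_total s a with hsa | has
    · exact (d1 s a hsa le_rfl).trans hsa hat (d2 a t hat le_rfl)
    · exact d2 s t hst has

end IsDissipative

/-- The inequality passes to pointwise limits, also with a varying right end point: the slope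
contribution is lower semicontinuous by Fatou's lemma. At the right end point an upper bound of the
limiting energy is enough. -/
lemma dissipatesOn_of_tendsto (hg : LowerSemicontinuous g) {w : ℕ → ℝ≥0 → S} {T : ℕ → ℝ≥0}
    {s t : ℝ≥0} {e : ℝ} (hst : s ≤ t) (hc : ∀ n, Continuous (w n))
    (hD : ∀ᶠ n in atTop, DissipatesOn φ g (w n) s (T n)) (hT : Tendsto T atTop (𝓝 t))
    (hw : ∀ r, s < r → r < t → Tendsto (fun n => w n r) atTop (𝓝 (u r)))
    (hs : Tendsto (fun n => w n s) atTop (𝓝 (u s)))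
    (ht : Tendsto (fun n => w n (T n)) atTop (𝓝 (u t)))
    (hes : Tendsto (fun n => energy φ (w n) s) atTop (𝓝 (energy φ u s)))
    (het : Tendsto (fun n => energy φ (w n) (T n)) atTop (𝓝 e)) (hle : energy φ u t ≤ e) :
    DissipatesOn φ g u s t := by
  rcases hst.eq_or_lt with rfl | hst'
  · exact dissipatesOn_self _
  have e0 : (t : ℝ) - s ≠ 0 := (sub_pos.2 (NNReal.coe_lt_coe.2 hst')).ne'
  set c : ℝ := 2 * (energy φ u s - e) - dist (u s) (u t) ^ 2 / ((t : ℝ) - s) with hcdef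
  have hlim : Tendsto (fun n => slack φ (w n) s (T n)) atTop (𝓝 c) := by
    have hT' : Tendsto (fun n => ((T n : ℝ≥0) : ℝ)) atTop (𝓝 (t : ℝ)) :=
      (NNReal.continuous_coe.tendsto t).comp hT
    exact ((hes.sub het).const_mul 2).sub
      (((hs.dist ht).pow 2).div (hT'.sub_const _) e0)
  have hc0 : 0 ≤ c := ge_of_tendsto hlim (hD.mono fun n h => h.1)
  have hcs : c ≤ slack φ u s t := by simp only [hcdef, slack]; linarith
  refine ⟨hc0.trans hcs, le_trans ?_ (ENNReal.ofReal_le_ofReal hcs)⟩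
  let _ : MeasurableSpace S := borel S
  have : BorelSpace S := ⟨rfl⟩
  have hG : LowerSemicontinuous (fun x => g x ^ 2) :=
    (ENNReal.continuous_pow 2).comp_lowerSemicontinuous hg fun a b h =>
      pow_le_pow_left₀ (by positivity) h 2
  have hmeas : ∀ n, Measurable
      ((Ioc (s : ℝ) (T n)).indicator fun r : ℝ => g (w n r.toNNReal) ^ 2) := fun n =>
    (hG.measurable.comp ((hc n).measurable.comp measurable_real_toNNReal)).indicator
      measurableSet_Ioc
  have h1 : slopeCost g u s t = ∫⁻ r, (Ioo (s : ℝ) t).indicator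
      (fun r : ℝ => g (u r.toNNReal) ^ 2) r := by
    rw [lintegral_indicator measurableSet_Ioo, slopeCost, restrict_Ioo_eq_restrict_Ioc]
  rw [h1]
  calc _ ≤ ∫⁻ r, liminf (fun n => (Ioc (s : ℝ) (T n)).indicator
        (fun r : ℝ => g (w n r.toNNReal) ^ 2) r) atTop := by
        refine lintegral_mono fun r => ?_
        by_cases hr : r ∈ Ioo (s : ℝ) t
        · rw [indicator_of_mem hr]
          have hr0 : (0 : ℝ) ≤ r := s.coe_nonneg.trans hr.1.le
          have hrs : s < r.toNNReal :=
            NNReal.coe_lt_coe.1 (by rw [Real.coe_toNNReal _ hr0]; exact hr.1)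
          have hrt : r.toNNReal < t :=
            NNReal.coe_lt_coe.1 (by rw [Real.coe_toNNReal _ hr0]; exact hr.2)
          have h2 : ∀ᶠ n in atTop, (Ioc (s : ℝ) (T n)).indicator
              (fun r : ℝ => g (w n r.toNNReal) ^ 2) r = g (w n r.toNNReal) ^ 2 := by
            filter_upwards [hT.eventually (lt_mem_nhds hrt)] with n hn
            rw [indicator_of_mem]
            exact ⟨hr.1, by rw [← Real.coe_toNNReal r hr0]; exact NNReal.coe_le_coe.2 hn.le⟩
          rw [liminf_congr h2]
          exact (hG.le_liminf (u r.toNNReal)).trans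
            (liminf_le_liminf_of_le (hw _ hrs hrt))
        · rw [indicator_of_notMem hr]; exact zero_le
    _ ≤ liminf (fun n => ∫⁻ r, (Ioc (s : ℝ) (T n)).indicator
        (fun r : ℝ => g (w n r.toNNReal) ^ 2) r) atTop := lintegral_liminf_le hmeas
    _ ≤ liminf (fun n => ENNReal.ofReal (slack φ (w n) s (T n))) atTop := by
        refine liminf_le_liminf ?_
        filter_upwards [hD] with n hn
        rw [lintegral_indicator measurableSet_Ioc]
        exact hn.2
    _ = ENNReal.ofReal c := (ENNReal.tendsto_ofReal hlim).liminf_eq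

lemma coe_ennreal_le_coe_iff {x : ℝ≥0∞} {r : ℝ} :
    (x : EReal) ≤ (r : EReal) ↔ 0 ≤ r ∧ x ≤ ENNReal.ofReal r := by
  constructor
  · intro h
    have hr : 0 ≤ r := EReal.coe_nonneg.1 ((EReal.coe_ennreal_nonneg x).trans h)
    refine ⟨hr, ?_⟩
    rw [← EReal.coe_ennreal_le_coe_ennreal_iff, EReal.coe_ennreal_ofReal, max_eq_left hr]
    exact h
  · rintro ⟨hr, h⟩
    rw [← EReal.coe_ennreal_le_coe_ennreal_iff, EReal.coe_ennreal_ofReal, max_eq_left hr] at h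
    exact h

lemma IsDissipative.of_mem_gradientFlow (hφ_bot : ∀ x, φ x ≠ ⊥) (h : u ∈ gradientFlow φ g) :
    IsDissipative φ g u := by
  obtain ⟨hac, h0, -, hE⟩ := h
  have htop : ∀ t, φ (u t) ≠ ⊤ := fun t ht => by
    have := (EReal.coe_ennreal_nonneg _).trans (hE 0 t zero_le)
    rw [ht, EReal.sub_top] at this
    exact absurd this (by simp)
  refine ⟨htop, fun s t hst => ?_⟩
  have h1 := hE s t hst
  rw [sub_eq_coe_energy_sub hφ_bot htop, coe_ennreal_le_coe_iff] at h1
  obtain ⟨hr, h1⟩ := h1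
  change 2⁻¹ * slopeCost g u s t + _ ≤ _ at h1
  set r := energy φ u s - energy φ u t with hrdef
  set A := slopeCost g u s t
  set M := ∫⁻ r in Ioc (s : ℝ) t, metricDeriv u r.toNNReal ^ 2
  have hlt := h1.trans_lt ENNReal.ofReal_lt_top
  have hA : A ≠ ⊤ := fun h => by simp [h, ENNReal.mul_top] at hlt
  have hM : M ≠ ⊤ := fun h => by simp [h, ENNReal.mul_top] at hlt
  have h2 := hac.sq_dist_le hst
  lift A to ℝ≥0 using hA with a ha
  change ENNReal.ofReal _ ≤ _ * M at h2
  lift M to ℝ≥0 using hM with m hm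
  have hst' : (0 : ℝ) ≤ t - s := sub_nonneg.2 hst
  have h3 : dist (u s) (u t) ^ 2 ≤ (t - s) * m := by
    rw [← ENNReal.ofReal_coe_nnreal, ← ENNReal.ofReal_mul hst',
      ENNReal.ofReal_le_ofReal_iff (by positivity)] at h2
    exact h2
  have h4 : (a : ℝ) / 2 + m / 2 ≤ r := by
    have := ENNReal.toReal_mono ENNReal.ofReal_ne_top h1
    rw [ENNReal.toReal_ofReal hr, ENNReal.toReal_add (by finiteness) (by finiteness)] at this
    simp at this
    linarith
  have h5 : dist (u s) (u t) ^ 2 / ((t : ℝ) - s) ≤ m :=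
    div_le_of_le_mul₀ hst' m.coe_nonneg (by linarith)
  have h6 : (a : ℝ) ≤ slack φ u s t := by rw [slack, ← hrdef]; linarith
  refine ⟨a.coe_nonneg.trans h6, ?_⟩
  change A ≤ _
  rw [← ha, ← ENNReal.ofReal_coe_nnreal]
  exact ENNReal.ofReal_le_ofReal h6

/-- The function `h = -2 φ(u) - ∫ g²(u)` is increasing and `d²(u(s), u(t)) ≤ (t - s)(h(t) - h(s))`.
Hence `|u'|² ≤ h'` almost everywhere, and `∫_s^t h' ≤ h(t) - h(s)`. -/
lemma IsDissipative.mem_gradientFlow (hφ_bot : ∀ x, φ x ≠ ⊥) (hg : LowerSemicontinuous g)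
    (hu : IsDissipative φ g u) : u ∈ gradientFlow φ g := by
  set h : ℝ → ℝ := fun x => 2 * (energy φ u 0 - energy φ u x.toNNReal) -
    (slopeCost g u 0 x.toNNReal).toReal with hdef
  have hadd : ∀ s t : ℝ≥0, s ≤ t → h t - h s =
      2 * (energy φ u s - energy φ u t) - (slopeCost g u s t).toReal := by
    intro s t hst
    simp only [hdef, Real.toNNReal_coe]
    rw [slopeCost_add g u (zero_le : 0 ≤ s) hst,
      ENNReal.toReal_add (hu.slopeCost_ne_top zero_le) (hu.slopeCost_ne_top hst)]
    ring
  have hbd : ∀ s t : ℝ≥0, s ≤ t → dist (u s) (u t) ^ 2 / ((t : ℝ) - s) ≤ h t - h s := by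
    intro s t hst
    have h1 := hu.dissipatesOn s t hst
    have h2 := ENNReal.toReal_mono ENNReal.ofReal_ne_top h1.2
    rw [ENNReal.toReal_ofReal h1.1, slack] at h2
    rw [hadd s t hst]
    linarith
  have hmono : Monotone h := by
    intro x y hxy
    have hxy' := Real.toNNReal_le_toNNReal hxy
    have h1 := hbd _ _ hxy'
    have h2 : 0 ≤ h y.toNNReal - h x.toNNReal :=
      (div_nonneg (sq_nonneg _) (sub_nonneg.2 (NNReal.coe_le_coe.2 hxy'))).trans h1
    simpa only [hdef, Real.toNNReal_coe, sub_nonneg] using h2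
  have hsq : ∀ s t : ℝ≥0, s ≤ t → dist (u s) (u t) ^ 2 ≤ (t - s) * (h t - h s) := by
    intro s t hst
    rcases hst.eq_or_lt with rfl | hst'
    · simp
    have e : (0 : ℝ) < t - s := sub_pos.2 hst'
    have := hbd s t hst
    rw [div_le_iff₀ e] at this
    linarith
  let _ : MeasurableSpace S := borel S
  have : BorelSpace S := ⟨rfl⟩
  refine ⟨IsLocAbsContinuous.of_sq_dist_le hmono hsq, lt_top_iff_ne_top.2 (hu.ne_top 0),
    hg.measurable.comp hu.continuous.measurable, fun s t hst => ?_⟩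
  have h1 := lintegral_sq_metricDeriv_le hmono hsq hst
  have hfin := hu.slopeCost_ne_top hst
  rw [sub_eq_coe_energy_sub hφ_bot hu.ne_top, coe_ennreal_le_coe_iff]
  refine ⟨sub_nonneg.2 (hu.energy_antitone hst), ?_⟩
  change 2⁻¹ * slopeCost g u s t + _ ≤ _
  rw [hadd s t hst] at h1
  have hnn : 0 ≤ 2 * (energy φ u s - energy φ u t) - (slopeCost g u s t).toReal := by
    rw [← hadd s t hst]; exact sub_nonneg.2 (hmono hst)
  calc _ ≤ 2⁻¹ * ENNReal.ofReal (slopeCost g u s t).toReal + 2⁻¹ * ENNReal.ofReal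
        (2 * (energy φ u s - energy φ u t) - (slopeCost g u s t).toReal) := by
        rw [ENNReal.ofReal_toReal hfin]; gcongr
    _ = ENNReal.ofReal (energy φ u s - energy φ u t) := by
        rw [← mul_add, ← ENNReal.ofReal_add ENNReal.toReal_nonneg hnn]
        have : (2⁻¹ : ℝ≥0∞) = ENNReal.ofReal 2⁻¹ := by
          rw [ENNReal.ofReal_inv_of_pos two_pos]; simp
        rw [this, ← ENNReal.ofReal_mul (by norm_num)]
        congr 1
        ring

lemma mem_gradientFlow_iff (hφ_bot : ∀ x, φ x ≠ ⊥) (hg : LowerSemicontinuous g) :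
    u ∈ gradientFlow φ g ↔ IsDissipative φ g u :=
  ⟨IsDissipative.of_mem_gradientFlow hφ_bot, IsDissipative.mem_gradientFlow hφ_bot hg⟩

end

section

variable {S : Type*} [MetricSpace S] {φ : S → EReal} {g : S → ℝ≥0∞} {u v w : ℝ≥0 → S}

/-! ### Extension beyond a finite time -/

/-- A curve which runs through the range of a solution `u` in finite time and converges forces `u`
to converge to the same point, because both run through the range in order of decreasing energy. -/
lemma IsDissipative.tendsto_of_image_eq_range (hu : IsDissipative φ g u) {θ : ℝ≥0}
    (hw : ∀ s t : ℝ≥0, s ≤ t → t < θ → energy φ w t ≤ energy φ w s)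
    (himg : w '' Iio θ = range u) {x : S} (hx : Tendsto w (𝓝[<] θ) (𝓝 x)) :
    Tendsto u atTop (𝓝 x) := by
  have hθ : 0 < θ := by
    obtain ⟨t, ht, -⟩ : u 0 ∈ w '' Iio θ := himg ▸ mem_range_self 0
    exact lt_of_le_of_lt zero_le ht
  intro N hN
  obtain ⟨l, hl, hlN⟩ := (mem_nhdsLT_iff_exists_Ioo_subset' hθ).1 (hx hN)
  obtain ⟨t₀, hlt₀, ht₀⟩ := exists_between (show l < θ from hl)
  obtain ⟨r₀, hr₀⟩ : w t₀ ∈ range u := himg ▸ mem_image_of_mem w ht₀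
  change ∀ᶠ r in atTop, u r ∈ N
  filter_upwards [eventually_ge_atTop r₀] with r hr
  obtain ⟨t, ht, hrt⟩ : u r ∈ w '' Iio θ := himg ▸ mem_range_self r
  rcases le_total t₀ t with h | h
  · rw [← hrt]
    exact hlN ⟨hlt₀.trans_le h, ht⟩
  · have h1 : energy φ u r₀ ≤ energy φ u r := by
      have := hw t t₀ h ht₀
      simpa only [energy, hr₀, hrt] using this
    have h2 := hu.eq_of_energy_eq (le_antisymm h1 (hu.energy_antitone hr))
    rw [← h2, hr₀]
    exact hlN ⟨hlt₀, ht₀⟩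

/-- The quadratic lower bound on `φ` prevents the energy from tending to `-∞` in finite time: on a
short interval before `θ` the displacement is controlled by the energy drop, which grows at most
quadratically in the displacement. -/
lemma exists_le_energy_of_lt {A B : ℝ} (hB : 0 < B) {x₀ : S}
    (hq : ∀ x, ((-A - B * dist x x₀ ^ 2 : ℝ) : EReal) ≤ φ x) {θ : ℝ≥0} (hθ : 0 < θ)
    (hw : ∀ T : ℝ≥0, T < θ → ∃ v, IsDissipative φ g v ∧ ∀ t ≤ T, v t = w t) :
    ∃ c : ℝ, ∀ t < θ, c ≤ energy φ w t := by
  have htop : ∀ t < θ, φ (w t) ≠ ⊤ := fun t ht => by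
    obtain ⟨v, hv, hvw⟩ := hw t ht
    rw [← hvw t le_rfl]; exact hv.ne_top t
  have hq' : ∀ t < θ, -A - B * dist (w t) x₀ ^ 2 ≤ energy φ w t := fun t ht =>
    EReal.coe_le_coe_iff.1 (by
      rw [energy, EReal.coe_toReal (htop t ht) (ne_bot_of_le_ne_bot (EReal.coe_ne_bot _) (hq _))]
      exact hq _)
  have hD : ∀ s t : ℝ≥0, s ≤ t → t < θ → DissipatesOn φ g w s t := fun s t hst ht => by
    obtain ⟨v, hv, hvw⟩ := hw t ht
    exact (dissipatesOn_congr hst fun r hr => (hvw r hr.2).symm).2 (hv.dissipatesOn s t hst)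
  -- For `t - t₀ ≤ δ = 1 / (8 B)` the displacement `D` satisfies `4 B D² ≤ φ(w(t₀)) - φ(w(t))`, which
  -- absorbs the term `2 B D²` of the quadratic bound.
  obtain ⟨δ, hδ⟩ : ∃ δ : ℝ≥0, (δ : ℝ) = 1 / (8 * B) := ⟨⟨1 / (8 * B), by positivity⟩, rfl⟩
  have hδ0 : 0 < δ := NNReal.coe_pos.1 (by rw [hδ]; positivity)
  set t₀ := θ - δ with ht₀
  have ht₀θ : t₀ < θ := tsub_lt_self hθ hδ0
  have hδt : ∀ t < θ, (t : ℝ) - t₀ ≤ δ := fun t ht => by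
    have : t ≤ t₀ + δ := ht.le.trans (by rw [ht₀]; exact le_tsub_add)
    have := NNReal.coe_le_coe.2 this
    push_cast at this
    linarith
  set d := dist (w t₀) x₀ with hd
  set C := energy φ w t₀ + A + 2 * B * d ^ 2 with hC
  have main : ∀ t, t₀ ≤ t → t < θ → -A - 2 * B * d ^ 2 - C ≤ energy φ w t := by
    intro t h0 ht
    have h1 := (hD t₀ t h0 ht).sq_dist_le h0
    have h2 := (hD t₀ t h0 ht).energy_le h0
    have h3 := hq' t ht
    set D := dist (w t₀) (w t) with hDdef
    have h4 : dist (w t) x₀ ^ 2 ≤ 2 * d ^ 2 + 2 * D ^ 2 := by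
      have : dist (w t) x₀ ≤ D + d := by
        have := dist_triangle (w t) (w t₀) x₀
        rwa [dist_comm (w t) (w t₀)] at this
      nlinarith [dist_nonneg (x := w t) (y := x₀), sq_nonneg (D - d)]
    have h5 : D ^ 2 ≤ 2 * δ * (energy φ w t₀ - energy φ w t) := by
      refine h1.trans ?_
      have := hδt t ht
      gcongr
    rw [hδ] at h5
    have h6 : 4 * B * D ^ 2 ≤ energy φ w t₀ - energy φ w t := by
      have : 4 * B * (2 * (1 / (8 * B)) * (energy φ w t₀ - energy φ w t)) =
          energy φ w t₀ - energy φ w t := by field_simp; norm_num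
      rw [← this]
      gcongr
    have h7 : B * dist (w t) x₀ ^ 2 ≤ B * (2 * d ^ 2 + 2 * D ^ 2) := by gcongr
    linarith
  refine ⟨-A - 2 * B * d ^ 2 - C, fun t ht => ?_⟩
  rcases le_total t₀ t with h | h
  · exact main t h ht
  · exact (main t₀ le_rfl ht₀θ).trans ((hD t t₀ h ht₀θ).energy_le h)

lemma exists_tendsto_nhdsLT [CompleteSpace S] {c : ℝ} {θ : ℝ≥0} (hθ : 0 < θ)
    (hc : ∀ t < θ, c ≤ energy φ w t)
    (hw : ∀ T : ℝ≥0, T < θ → ∃ v, IsDissipative φ g v ∧ ∀ t ≤ T, v t = w t) :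
    ∃ x, Tendsto w (𝓝[<] θ) (𝓝 x) := by
  have : NeBot (𝓝[<] θ) := nhdsLT_neBot_of_exists_lt ⟨0, hθ⟩
  refine cauchy_map_iff_exists_tendsto.1 (Metric.cauchy_iff.2 ⟨inferInstance, fun ε hε => ?_⟩)
  set K := energy φ w 0 - c with hK
  have hK0 : 0 ≤ K := sub_nonneg.2 (hc 0 hθ)
  have hbound : ∀ s < θ, ∀ t < θ, dist (w s) (w t) ^ 2 ≤ 2 * dist s t * K := by
    intro s hs t ht
    obtain ⟨v, hv, hvw⟩ := hw (max s t) (max_lt hs ht)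
    rw [← hvw s (le_max_left _ _), ← hvw t (le_max_right _ _)]
    refine (hv.sq_dist_le_of_le (le_max_left s t) (le_max_right s t)).trans ?_
    have h1 : energy φ v 0 = energy φ w 0 := by simp only [energy, hvw 0 zero_le]
    have h2 := hc _ (max_lt hs ht)
    have h3 : energy φ v (max s t) = energy φ w (max s t) := by simp only [energy, hvw _ le_rfl]
    rw [h1, h3, hK]
    gcongr
  set η := ε ^ 2 / (4 * (K + 1)) with hη
  have hη0 : 0 < η := by positivity
  refine ⟨w '' (Metric.ball θ η ∩ Iio θ), image_mem_map (inter_mem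
    (mem_nhdsWithin_of_mem_nhds (Metric.ball_mem_nhds θ hη0)) self_mem_nhdsWithin), ?_⟩
  rintro _ ⟨s, ⟨hs, hsθ⟩, rfl⟩ _ ⟨t, ⟨ht, htθ⟩, rfl⟩
  have h1 := hbound s hsθ t htθ
  have h2 : dist s t < 2 * η := by
    have := dist_triangle_right s t θ
    rw [Metric.mem_ball] at hs ht
    linarith
  have h3 : 2 * dist s t * K < ε ^ 2 := by
    calc 2 * dist s t * K ≤ 2 * dist s t * (K + 1) := by gcongr; linarith
      _ < 2 * (2 * η) * (K + 1) := by gcongr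
      _ = ε ^ 2 := by rw [hη]; field_simp; norm_num
  exact lt_of_pow_lt_pow_left₀ 2 hε.le (h1.trans_lt h3)

lemma IsDissipative.antitone (hφ_bot : ∀ x, φ x ≠ ⊥) (hu : IsDissipative φ g u) :
    Antitone (fun t => φ (u t)) := by
  intro s t hst
  have := hu.energy_antitone hst
  simp only
  rw [← EReal.coe_toReal (hu.ne_top s) (hφ_bot _), ← EReal.coe_toReal (hu.ne_top t) (hφ_bot _)]
  exact EReal.coe_le_coe_iff.2 this

lemma IsDissipative.le_of_tendsto (hφ_bot : ∀ x, φ x ≠ ⊥) (hφ : LowerSemicontinuous φ)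
    (hu : IsDissipative φ g u) {x : S} (hx : Tendsto u atTop (𝓝 x)) (t : ℝ≥0) :
    φ x ≤ φ (u t) := by
  by_contra! hlt
  obtain ⟨s, hs1, hs2⟩ := ((hx.eventually (hφ x _ hlt)).and (eventually_ge_atTop t)).exists
  exact absurd (hu.antitone hφ_bot hs2) (not_le.2 hs1)

/-- The slope vanishes at the limit of a solution of bounded energy, since `∫ g²(u)` is finite on
the half-line. -/
lemma IsDissipative.slope_eq_zero_of_tendsto (hg : LowerSemicontinuous g)
    (hu : IsDissipative φ g u) {c : ℝ} (hc : ∀ t, c ≤ energy φ u t) {x : S}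
    (hx : Tendsto u atTop (𝓝 x)) : g x = 0 := by
  by_contra hne
  obtain ⟨η, hη0, hη⟩ := ENNReal.lt_iff_exists_nnreal_btwn.1 (pos_iff_ne_zero.2 hne)
  obtain ⟨a, ha⟩ := eventually_atTop.1 (hx.eventually (hg x _ hη))
  have hη0' : (0 : ℝ) < η := by exact_mod_cast hη0
  set K : ℝ := 2 * (energy φ u a - c) with hK
  have hK0 : 0 ≤ K := by have := hc a; rw [hK]; linarith
  have key : ∀ t, a ≤ t → (η : ℝ) ^ 2 * (t - a) ≤ K := by
    intro t hat
    have hat' : (0 : ℝ) ≤ t - a := sub_nonneg.2 hat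
    have h1 : ENNReal.ofReal ((η : ℝ) ^ 2 * (t - a)) ≤ slopeCost g u a t := by
      calc _ = ∫⁻ r in Ioc (a : ℝ) t, (η : ℝ≥0∞) ^ 2 := by
            rw [setLIntegral_const, Real.volume_Ioc, ENNReal.ofReal_mul (by positivity),
              ENNReal.ofReal_pow (by positivity), ENNReal.ofReal_coe_nnreal]
        _ ≤ _ := by
            refine setLIntegral_mono' measurableSet_Ioc fun r hr => ?_
            exact pow_le_pow_left₀ (by positivity)
              (ha _ (NNReal.le_toNNReal_of_coe_le hr.1.le)).le 2
    have h2 := (h1.trans (hu.dissipatesOn a t hat).2)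
    rw [ENNReal.ofReal_le_ofReal_iff (hu.dissipatesOn a t hat).1, slack] at h2
    have h3 : 0 ≤ dist (u a) (u t) ^ 2 / ((t : ℝ) - a) := by positivity
    have h4 := hc t
    rw [hK]
    linarith
  have h5 := key (a + ⟨(K + 1) / (η : ℝ) ^ 2, by positivity⟩) le_self_add
  change (η : ℝ) ^ 2 * (a + (K + 1) / (η : ℝ) ^ 2 - a) ≤ K at h5
  have h6 : (η : ℝ) ^ 2 * (a + (K + 1) / (η : ℝ) ^ 2 - a) = K + 1 := by field_simp; ring
  linarith

lemma isDissipative_const {x : S} (hx : φ x ≠ ⊤) (hgx : g x = 0) :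
    IsDissipative φ g (fun _ => x) :=
  ⟨fun _ => hx, fun s t _ => by simp [DissipatesOn, slack, slopeCost, energy, hgx]⟩

/-- A curve which follows solutions on `[0, θ)` and runs through the whole range of a solution `u`
extends by the common limit of both. The limit is an equilibrium: its slope vanishes because `u` is
defined for all times. -/
lemma isDissipative_extension [CompleteSpace S] (hφ_bot : ∀ x, φ x ≠ ⊥)
    (hφ : LowerSemicontinuous φ) (hg : LowerSemicontinuous g) {A B : ℝ} (hB : 0 < B) {x₀ : S}
    (hq : ∀ x, ((-A - B * dist x x₀ ^ 2 : ℝ) : EReal) ≤ φ x)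
    (hu : IsDissipative φ g u) {θ : ℝ≥0}
    (hw : ∀ T : ℝ≥0, T < θ → ∃ v, IsDissipative φ g v ∧ ∀ t ≤ T, v t = w t)
    (himg : w '' Iio θ = range u) :
    ∃ x : S, Tendsto u atTop (𝓝 x) ∧ Tendsto w (𝓝[<] θ) (𝓝 x) ∧
      IsDissipative φ g (fun t => if t < θ then w t else x) := by
  have hθ : 0 < θ := by
    obtain ⟨t, ht, -⟩ : u 0 ∈ w '' Iio θ := himg ▸ mem_range_self 0
    exact lt_of_le_of_lt zero_le ht
  obtain ⟨c, hc⟩ := exists_le_energy_of_lt hB hq hθ hw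
  obtain ⟨x, hx⟩ := exists_tendsto_nhdsLT hθ hc hw
  have hD : ∀ s t : ℝ≥0, s ≤ t → t < θ → DissipatesOn φ g w s t := fun s t hst ht => by
    obtain ⟨v, hv, hvw⟩ := hw t ht
    exact (dissipatesOn_congr hst fun r hr => (hvw r hr.2).symm).2 (hv.dissipatesOn s t hst)
  have hux := hu.tendsto_of_image_eq_range (fun s t hst ht => (hD s t hst ht).energy_le hst)
    himg hx
  have hcu : ∀ t, c ≤ energy φ u t := fun t => by
    obtain ⟨s, hs, hst⟩ : u t ∈ w '' Iio θ := himg ▸ mem_range_self t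
    have := hc s hs
    simpa only [energy, hst] using this
  have hgx := hu.slope_eq_zero_of_tendsto hg hcu hux
  have hxle := hu.le_of_tendsto hφ_bot hφ hux
  have hxtop : φ x ≠ ⊤ := fun h => hu.ne_top 0 (top_le_iff.1 (h ▸ hxle 0))
  refine ⟨x, hux, hx, ?_⟩
  set W : ℝ≥0 → S := fun t => if t < θ then w t else x with hW
  have hW1 : ∀ t < θ, W t = w t := fun t ht => if_pos ht
  have hW2 : ∀ t, θ ≤ t → W t = x := fun t ht => if_neg (not_lt.2 ht)
  have d1 : ∀ s t, s ≤ t → t < θ → DissipatesOn φ g W s t := fun s t hst ht =>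
    (dissipatesOn_congr hst fun r hr => hW1 r (hr.2.trans_lt ht)).2 (hD s t hst ht)
  have d3 : ∀ s t, s ≤ t → θ ≤ s → DissipatesOn φ g W s t := fun s t hst hs =>
    (dissipatesOn_congr hst fun r hr => hW2 r (hs.trans hr.1)).2
      ((isDissipative_const hxtop hgx).dissipatesOn s t hst)
  have d2 : ∀ s, s < θ → DissipatesOn φ g W s θ := by
    intro s hs
    obtain ⟨T, hTm, hT, hTlim⟩ := exists_seq_strictMono_tendsto' hθ
    choose V hV hVw using fun n => hw (T n) (hT n).2
    have hev : ∀ r < θ, ∀ᶠ n in atTop, r ≤ T n := fun r hr =>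
      (hTlim.eventually (lt_mem_nhds hr)).mono fun _ => le_of_lt
    have hVW : ∀ r < θ, ∀ᶠ n in atTop, V n r = W r := fun r hr =>
      (hev r hr).mono fun n hn => by rw [hVw n r hn, hW1 r hr]
    have hTw : ∀ n, V n (T n) = w (T n) := fun n => hVw n _ le_rfl
    have hTθ : Tendsto T atTop (𝓝[<] θ) :=
      tendsto_nhdsWithin_iff.2 ⟨hTlim, Eventually.of_forall fun n => (hT n).2⟩
    have hanti : Antitone fun n => energy φ w (T n) := fun m n hmn =>
      (hD _ _ (hTm.monotone hmn) (hT n).2).energy_le (hTm.monotone hmn)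
    have hlim := tendsto_atTop_ciInf hanti ⟨c, by rintro _ ⟨n, rfl⟩; exact hc _ (hT n).2⟩
    refine dissipatesOn_of_tendsto hg (w := V) (T := T) hs.le (fun n => (hV n).continuous)
      ((hev s hs).mono fun n hn => (hV n).dissipatesOn _ _ hn) hTlim
      (fun r _ hr => tendsto_const_nhds.congr' ((hVW r hr).mono fun n hn => hn.symm))
      (tendsto_const_nhds.congr' ((hVW s hs).mono fun n hn => hn.symm)) ?_
      (tendsto_const_nhds.congr' ((hVW s hs).mono fun n hn => by simp only [energy, hn]))
      (e := ⨅ n, energy φ w (T n)) ?_ ?_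
    · simp only [hTw, hW2 θ le_rfl]
      exact hx.comp hTθ
    · simp only [energy, hTw]
      exact hlim
    · refine le_ciInf fun n => ?_
      obtain ⟨r, hr⟩ : w (T n) ∈ range u := himg ▸ mem_image_of_mem w (hT n).2
      simp only [energy, hW2 θ le_rfl, ← hr]
      exact EReal.toReal_le_toReal (hxle r) (hφ_bot _) (hu.ne_top r)
  refine ⟨fun t => ?_, fun s t hst => ?_⟩
  · rcases lt_or_ge t θ with h | h
    · obtain ⟨v, hv, hvw⟩ := hw t h
      rw [hW1 t h, ← hvw t le_rfl]; exact hv.ne_top t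
    · rw [hW2 t h]; exact hxtop
  · rcases lt_or_ge t θ with ht | ht
    · exact d1 s t hst ht
    rcases lt_or_ge s θ with hs | hs
    · exact (d2 s hs).trans hs.le ht (d3 θ t ht le_rfl)
    · exact d3 s t hst hs

lemma isDissipative_of_forall_Icc
    (hw : ∀ T : ℝ≥0, 0 < T → ∃ v, IsDissipative φ g v ∧ ∀ t ≤ T, v t = w t) :
    IsDissipative φ g w := by
  refine ⟨fun t => ?_, fun s t hst => ?_⟩
  · obtain ⟨v, hv, hvw⟩ := hw (t + 1) (by positivity)
    rw [← hvw t le_self_add]; exact hv.ne_top t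
  · obtain ⟨v, hv, hvw⟩ := hw (t + 1) (by positivity)
    exact (dissipatesOn_congr hst fun r hr => (hvw r (hr.2.trans le_self_add)).symm).2
      (hv.dissipatesOn s t hst)

/-! ### Compactness of families of solutions with values in the range of a solution -/

/-- The energy is continuous on compact pieces of the range of a solution. -/
lemma IsDissipative.tendsto_toReal_of_mem (hu : IsDissipative φ g u)
    (hcont : Continuous (energy φ u)) {b : ℝ≥0} {p : ℕ → S} (hp : ∀ n, p n ∈ u '' Icc 0 b) {x : S}
    (hx : Tendsto p atTop (𝓝 x)) :
    Tendsto (fun n => (φ (p n)).toReal) atTop (𝓝 (φ x).toReal) := by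
  choose r hr hrp using hp
  refine tendsto_of_subseq_tendsto fun ns hns => ?_
  obtain ⟨a, -, k, hk, hlim⟩ := isCompact_Icc.tendsto_subseq (fun n => hr (ns n))
  refine ⟨k, ?_⟩
  have h1 : Tendsto (fun n => u (r (ns (k n)))) atTop (𝓝 (u a)) :=
    (hu.continuous.tendsto a).comp hlim
  have h2 : Tendsto (fun n => u (r (ns (k n)))) atTop (𝓝 x) := by
    simp only [hrp]
    exact hx.comp (hns.comp hk.tendsto_atTop)
  rw [← tendsto_nhds_unique h1 h2]
  have h3 := (hcont.tendsto a).comp hlim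
  simpa only [energy, Function.comp_def, hrp] using h3

/-- Solutions with values at time `t` in a fixed compact piece of the range of a solution `y` have a
subsequence converging to a solution: they are uniformly Hölder continuous on bounded intervals, and
the energy is continuous on these pieces. -/
theorem exists_subseq_tendsto_of_mem_image (hg : LowerSemicontinuous g)
    {y : ℝ≥0 → S} (hy : IsDissipative φ g y) (hcont : Continuous (energy φ y)) {c : ℝ≥0 → ℝ≥0}
    {U : ℕ → ℝ≥0 → S} (hU : ∀ n, IsDissipative φ g (U n))
    (hK : ∀ n t, U n t ∈ y '' Icc 0 (c t)) :
    ∃ w, IsDissipative φ g w ∧ (∀ t, w t ∈ y '' Icc 0 (c t)) ∧ ∃ k : ℕ → ℕ, StrictMono k ∧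
      ∀ (τ : ℕ → ℝ≥0) (t : ℝ≥0), Tendsto τ atTop (𝓝 t) →
        Tendsto (fun n => U (k n) (τ n)) atTop (𝓝 (w t)) := by
  have hcpt : ∀ t, IsCompact (y '' Icc 0 (c t)) := fun t => isCompact_Icc.image hy.continuous
  set K : ℝ≥0 → ℝ := fun T => energy φ y 0 - energy φ y (c T) with hKdef
  have hK0 : ∀ T, 0 ≤ K T := fun T => sub_nonneg.2 (hy.energy_antitone zero_le)
  have hbd : ∀ n (s t T : ℝ≥0), s ≤ T → t ≤ T →
      dist (U n s) (U n t) ^ 2 ≤ 2 * dist s t * K T := by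
    intro n s t T hs ht
    refine ((hU n).sq_dist_le_of_le hs ht).trans ?_
    have h1 : energy φ (U n) 0 ≤ energy φ y 0 := by
      obtain ⟨r, -, hr⟩ := hK n 0
      have := hy.energy_antitone (zero_le : 0 ≤ r)
      simpa only [energy, hr] using this
    have h2 : energy φ y (c T) ≤ energy φ (U n) T := by
      obtain ⟨r, hr', hr⟩ := hK n T
      have := hy.energy_antitone hr'.2
      simpa only [energy, hr] using this
    simp only [hKdef]
    gcongr
  obtain ⟨F, -, k, hk, hF⟩ := (isCompact_univ_pi
    fun j => hcpt (TopologicalSpace.denseSeq ℝ≥0 j)).tendsto_subseq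
    (x := fun n j => U n (TopologicalSpace.denseSeq ℝ≥0 j)) (fun n j _ => hK n _)
  rw [tendsto_pi_nhds] at hF
  have hcauchy : ∀ t, CauchySeq fun n => U (k n) t := by
    intro t
    rw [Metric.cauchySeq_iff]
    intro ε hε
    set η := min 1 ((ε / 3) ^ 2 / (2 * (K (t + 1) + 1))) with hη
    have hKt := hK0 (t + 1)
    have hη0 : 0 < η := by positivity
    obtain ⟨j, hq⟩ := (TopologicalSpace.denseRange_denseSeq ℝ≥0).exists_dist_lt t hη0
    set q := TopologicalSpace.denseSeq ℝ≥0 j with hqdef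
    have hqt : q ≤ t + 1 := by
      have h1 : dist t q < 1 := hq.trans_le (min_le_left _ _)
      rw [dist_comm, NNReal.dist_eq] at h1
      have h2 := (abs_lt.1 h1).2
      exact NNReal.coe_le_coe.1 (by push_cast; linarith)
    have h3 : ∀ n, dist (U n t) (U n q) < ε / 3 := by
      intro n
      have h1 := hbd n t q (t + 1) le_self_add hqt
      refine lt_of_pow_lt_pow_left₀ 2 (by positivity) (h1.trans_lt ?_)
      calc 2 * dist t q * K (t + 1) ≤ 2 * dist t q * (K (t + 1) + 1) := by gcongr; linarith
        _ < 2 * ((ε / 3) ^ 2 / (2 * (K (t + 1) + 1))) * (K (t + 1) + 1) := by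
          gcongr
          exact hq.trans_le (min_le_right _ _)
        _ = (ε / 3) ^ 2 := by field_simp
    obtain ⟨N, hN⟩ := Metric.cauchySeq_iff.1 (hF j).cauchySeq (ε / 3) (by positivity)
    refine ⟨N, fun m hm n hn => ?_⟩
    have h4 := hN m hm n hn
    simp only [Function.comp_def] at h4
    calc _ ≤ dist (U (k m) t) (U (k m) q) + dist (U (k m) q) (U (k n) q) +
          dist (U (k n) q) (U (k n) t) := dist_triangle4 _ _ _ _
      _ < ε / 3 + ε / 3 + ε / 3 := by
          have := h3 (k n)
          rw [dist_comm] at this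
          exact add_lt_add (add_lt_add (h3 _) h4) this
      _ = ε := by ring
  choose w hwm hw using fun t => cauchySeq_tendsto_of_isComplete (hcpt t).isComplete
    (fun n => hK (k n) t) (hcauchy t)
  refine ⟨w, ⟨fun t => ?_, fun s t hst => ?_⟩, hwm, k, hk, fun τ t hτ => ?_⟩
  · obtain ⟨r, -, hr⟩ := hwm t
    rw [← hr]; exact hy.ne_top r
  · exact dissipatesOn_of_tendsto hg (w := fun n => U (k n)) (T := fun _ => t) hst
      (fun n => (hU _).continuous)
      (Eventually.of_forall fun n => (hU _).dissipatesOn s t hst) tendsto_const_nhds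
      (fun r _ _ => hw r) (hw s) (hw t) (hy.tendsto_toReal_of_mem hcont (fun n => hK _ s) (hw s))
      (hy.tendsto_toReal_of_mem hcont (fun n => hK _ t) (hw t)) le_rfl
  · rw [tendsto_iff_dist_tendsto_zero]
    have h1 : Tendsto (fun n => √(2 * dist (τ n) t * K (t + 1)) + dist (U (k n) t) (w t)) atTop
        (𝓝 (√(2 * 0 * K (t + 1)) + 0)) :=
      (((tendsto_iff_dist_tendsto_zero.1 hτ).const_mul 2).mul_const _).sqrt.add
        (tendsto_iff_dist_tendsto_zero.1 (hw t))
    rw [mul_zero, zero_mul, Real.sqrt_zero, add_zero] at h1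
    refine squeeze_zero' (Eventually.of_forall fun _ => dist_nonneg) ?_ h1
    filter_upwards [hτ.eventually (Iic_mem_nhds (lt_add_one t))] with n hn
    refine (dist_triangle _ (U (k n) t) _).trans (add_le_add_left ?_ _)
    exact Real.le_sqrt_of_sq_le (hbd _ _ _ _ hn le_self_add)

end

section

variable {S : Type*} [MetricSpace S] {φ : S → EReal} {g : S → ℝ≥0∞} {u v w y : ℝ≥0 → S}

/-! ### Solutions on the range of a given solution -/

/-- The standing assumptions on the energy `φ` and the slope `g`. -/
structure IsAdmissible (φ : S → EReal) (g : S → ℝ≥0∞) : Prop where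
  ne_bot : ∀ x, φ x ≠ ⊥
  lsc_energy : LowerSemicontinuous φ
  lsc_slope : LowerSemicontinuous g
  quadratic_bound : ∃ A B : ℝ, 0 < B ∧ ∃ x₀ : S,
    ∀ x, ((-A - B * dist x x₀ ^ 2 : ℝ) : EReal) ≤ φ x
  continuous_energy : ∀ u, IsDissipative φ g u → Continuous (energy φ u)

/-- The family of all solutions of the derivative-free inequality. -/
def dissipativeCurves (φ : S → EReal) (g : S → ℝ≥0∞) : Set (ℝ≥0 → S) :=
  {u | IsDissipative φ g u}

lemma rangeClosure_eq_closure {X : Type*} [MetricSpace X] {u : ℝ≥0 → X} (hu : Continuous u) :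
    rangeClosure u = closure (range u) := by
  apply Subset.antisymm
  · rintro x (hx | ⟨t, -, ht⟩)
    · exact subset_closure hx
    · exact mem_closure_of_tendsto ht (Eventually.of_forall fun n => mem_range_self _)
  · intro x hx
    obtain ⟨p, hp, hpx⟩ := mem_closure_iff_seq_limit.1 hx
    choose s hs using hp
    by_cases h : Tendsto s atTop atTop
    · exact Or.inr ⟨s, h, by simpa only [hs] using hpx⟩
    · left
      rw [tendsto_atTop] at h
      push Not at h
      obtain ⟨b, hb⟩ := h
      have hb' : ∃ᶠ n in atTop, s n ∈ Icc 0 b := by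
        refine Frequently.mono (f := atTop) hb fun n hn => ?_
        exact ⟨zero_le, hn.le⟩
      obtain ⟨a, -, k, hk, hlim⟩ := isCompact_Icc.tendsto_subseq' hb'
      refine ⟨a, tendsto_nhds_unique ((hu.tendsto a).comp hlim) ?_⟩
      simp only [Function.comp_def, hs]
      exact hpx.comp hk.tendsto_atTop

namespace IsDissipative

lemma mem_image_Icc_of_energy_le (hy : IsDissipative φ g y) {r : ℝ≥0} {q : S} (hq : q ∈ range y)
    (h : (φ (y r)).toReal ≤ (φ q).toReal) : q ∈ y '' Icc 0 r := by
  obtain ⟨s, rfl⟩ := hq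
  rcases le_total s r with hs | hs
  · exact ⟨s, ⟨zero_le, hs⟩, rfl⟩
  · exact ⟨r, ⟨zero_le, le_rfl⟩, hy.eq_of_energy_eq (le_antisymm h (hy.energy_antitone hs))⟩

lemma injOn_toReal_range (hy : IsDissipative φ g y) :
    InjOn (fun x => (φ x).toReal) (range y) := by
  rintro _ ⟨s, rfl⟩ _ ⟨t, rfl⟩ h
  exact hy.eq_of_energy_eq h

lemma energy_le_of_le (hφ_bot : ∀ x, φ x ≠ ⊥) (hu : IsDissipative φ g u) {x : S} {t : ℝ≥0}
    (h : φ x ≤ φ (u t)) : (φ x).toReal ≤ energy φ u t :=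
  EReal.toReal_le_toReal h (hφ_bot _) (hu.ne_top t)

lemma le_zero_of_mem_closure (hA : IsAdmissible φ g) (hy : IsDissipative φ g y) {x : S}
    (hx : x ∈ closure (range y)) : φ x ≤ φ (y 0) := by
  have hcl : IsClosed {x | φ x ≤ φ (y 0)} := hA.lsc_energy.isClosed_preimage _
  refine closure_minimal ?_ hcl hx
  rintro _ ⟨t, rfl⟩
  exact hy.antitone hA.ne_bot zero_le

lemma le_of_mem_closure_diff (hA : IsAdmissible φ g) (hy : IsDissipative φ g y) {x : S}
    (hx : x ∈ closure (range y)) (hx' : x ∉ range y) (t : ℝ≥0) : φ x ≤ φ (y t) := by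
  rw [← rangeClosure_eq_closure hy.continuous] at hx
  obtain ⟨s, hs, hsx⟩ := hx.resolve_left hx'
  have hcl : IsClosed {x | φ x ≤ φ (y t)} := hA.lsc_energy.isClosed_preimage _
  refine hcl.mem_of_tendsto hsx ?_
  filter_upwards [hs.eventually_ge_atTop t] with n hn
  exact hy.antitone hA.ne_bot hn

lemma isClosed_range_of_energy_le (hy : IsDissipative φ g y) {r : ℝ≥0}
    (h : ∀ s, energy φ y r ≤ energy φ y s) : IsClosed (range y) := by
  have : range y = y '' Icc 0 r :=
    Subset.antisymm (fun q hq => hy.mem_image_Icc_of_energy_le hq (by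
      obtain ⟨s, rfl⟩ := hq; exact h s)) (image_subset_range _ _)
  rw [this]
  exact (isCompact_Icc.image hy.continuous).isClosed

lemma apply_zero_eq (hA : IsAdmissible φ g) (hy : IsDissipative φ g y) (hv : IsDissipative φ g v)
    (h1 : range y ⊆ range v) (h2 : range v ⊆ closure (range y)) : v 0 = y 0 := by
  obtain ⟨t, ht⟩ := h1 (mem_range_self 0)
  rw [← ht]
  refine hv.eq_of_energy_eq (le_antisymm ?_ (hv.energy_antitone zero_le))
  have := hy.energy_le_of_le hA.ne_bot (hy.le_zero_of_mem_closure hA (h2 (mem_range_self 0)))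
  simpa only [energy, ht] using this

end IsDissipative

/-- The existence of the exit time `θ` in the definition of `solutionsOnRange` is automatic. -/
lemma mem_solutionsOnRange_iff (hA : IsAdmissible φ g) (hy : IsDissipative φ g y) :
    v ∈ solutionsOnRange (dissipativeCurves φ g) y ↔
      IsDissipative φ g v ∧ range y ⊆ range v ∧ range v ⊆ closure (range y) := by
  rw [← rangeClosure_eq_closure hy.continuous]
  refine ⟨fun h => ⟨h.1, h.2.1, h.2.2.1⟩, fun ⟨hv, h1, h2⟩ => ⟨hv, h1, h2, ?_⟩⟩
  rw [rangeClosure_eq_closure hy.continuous] at h2 ⊢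
  have hout : ∀ t, v t ∉ range y → ∀ s, energy φ v t ≤ energy φ y s := fun t ht s =>
    hy.energy_le_of_le hA.ne_bot (hy.le_of_mem_closure_diff hA (h2 (mem_range_self t)) ht s)
  have hstay : ∀ s t, s ≤ t → v s ∉ range y → v t ∉ range y := by
    rintro s t hst hs ⟨r, hr⟩
    have h3 := hout s hs r
    have h4 : energy φ y r = energy φ v t := by simp only [energy, hr]
    rw [h4] at h3
    exact hs ⟨r, by rw [hr, hv.eq_of_energy_eq (le_antisymm h3 (hv.energy_antitone hst))]⟩
  by_cases hN : ∃ t, v t ∉ range y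
  swap
  · push Not at hN
    refine ⟨⊤, by simp, ?_, ?_⟩
    · simp only [ENNReal.coe_lt_top, ofPred_true, image_univ]
      exact Subset.antisymm (by rintro _ ⟨t, rfl⟩; exact hN t) h1
    · simp
  set N : Set ℝ≥0 := {t | v t ∉ range y} with hNdef
  set θ : ℝ≥0 := sInf N with hθ
  have hgt : ∀ t, θ < t → v t ∉ range y := fun t ht => by
    obtain ⟨s, hs, hst⟩ := exists_lt_of_csInf_lt hN ht
    exact hstay s t hst.le hs
  have hlt : ∀ t, t < θ → v t ∈ range y := fun t ht => by
    by_contra h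
    exact absurd (csInf_le' (show t ∈ N from h)) (not_le.2 ht)
  have hθN : v θ ∉ range y := by
    rintro ⟨r, hr⟩
    -- Otherwise `v θ` has least energy on the range of `y`, which is then closed.
    have h3 : ∀ s, energy φ v θ ≤ energy φ y s := fun s => by
      have hc : Tendsto (energy φ v) (𝓝[>] θ) (𝓝 (energy φ v θ)) :=
        ((hA.continuous_energy v hv).tendsto θ).mono_left nhdsWithin_le_nhds
      refine le_of_tendsto hc ?_
      filter_upwards [self_mem_nhdsWithin] with t ht
      exact hout t (hgt t ht) s
    have h4 : IsClosed (range y) := hy.isClosed_range_of_energy_le (r := r) fun s => by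
      have := h3 s
      simpa only [energy, hr] using this
    obtain ⟨t, ht⟩ := hN
    rw [h4.closure_eq] at h2
    exact ht (h2 (mem_range_self t))
  have hge : ∀ t, θ ≤ t → v t ∉ range y := fun t ht => hstay θ t ht hθN
  have hθ0 : 0 < θ := by
    rw [pos_iff_ne_zero]
    intro h
    rw [h, hy.apply_zero_eq hA hv h1 h2] at hθN
    exact hθN (mem_range_self 0)
  refine ⟨θ, by exact_mod_cast hθ0, ?_, ?_⟩
  · simp only [ENNReal.coe_lt_coe]
    refine Subset.antisymm (by rintro _ ⟨t, ht, rfl⟩; exact hlt t ht) fun q hq => ?_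
    obtain ⟨t, rfl⟩ := h1 hq
    exact ⟨t, lt_of_not_ge fun h => hge t h hq, rfl⟩
  · simp only [ENNReal.coe_le_coe]
    rintro _ ⟨t, ht, rfl⟩
    exact ⟨h2 (mem_range_self t), hge t ht⟩

lemma self_mem_solutionsOnRange (hA : IsAdmissible φ g) (hy : IsDissipative φ g y) :
    y ∈ solutionsOnRange (dissipativeCurves φ g) y :=
  (mem_solutionsOnRange_iff hA hy).2 ⟨hy, Subset.rfl, subset_closure⟩

/-- After leaving the range of `y`, a solution rests at the limit of `y`. -/
lemma eq_of_notMem_range [CompleteSpace S] (hA : IsAdmissible φ g) (hy : IsDissipative φ g y)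
    (hv : IsDissipative φ g v) {θ : ℝ≥0} (h1 : v '' Iio θ = range y)
    (h2 : v '' Ici θ ⊆ closure (range y) \ range y) {t : ℝ≥0} (ht : θ ≤ t) : v t = v θ := by
  obtain ⟨A, B, hB, x₀, hq⟩ := hA.quadratic_bound
  obtain ⟨x, hx, -, -⟩ := isDissipative_extension hA.ne_bot hA.lsc_energy hA.lsc_slope hB hq hy
    (w := v) (θ := θ) (fun T _ => ⟨v, hv, fun _ _ => rfl⟩) h1
  have key : ∀ s, θ ≤ s → v s = x := fun s hs => by
    have h3 := h2 (mem_image_of_mem v hs)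
    rw [← rangeClosure_eq_closure hy.continuous] at h3
    obtain ⟨r, hr, hrx⟩ := h3.1.resolve_left h3.2
    exact tendsto_nhds_unique hrx (hx.comp hr)
  rw [key t ht, key θ le_rfl]

/-! ### The least time needed to reach a point -/

/-- Concatenation of two curves at time `a`. -/
def concat {X : Type*} (a : ℝ≥0) (u v : ℝ≥0 → X) : ℝ≥0 → X :=
  fun t => if t ≤ a then u t else v (t - a)

lemma concat_apply_of_le {X : Type*} {u v : ℝ≥0 → X} {a t : ℝ≥0} (h : t ≤ a) :
    concat a u v t = u t := if_pos h

lemma concat_apply_add {X : Type*} {u v : ℝ≥0 → X} {a : ℝ≥0} (h : v 0 = u a) (t : ℝ≥0) :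
    concat a u v (a + t) = v t := by
  by_cases ht : a + t ≤ a
  · have : t = 0 := by simpa using ht
    subst this
    rw [concat_apply_of_le ht, h, add_zero]
  · rw [concat, if_neg ht, add_tsub_cancel_left]

lemma concat_cases {X : Type*} {u v : ℝ≥0 → X} {a : ℝ≥0} (h : v 0 = u a) (t : ℝ≥0) :
    (t ≤ a ∧ concat a u v t = u t) ∨ ∃ s, t = a + s ∧ concat a u v t = v s := by
  rcases le_total t a with ht | ht
  · exact Or.inl ⟨ht, concat_apply_of_le ht⟩
  · obtain ⟨s, rfl⟩ := exists_add_of_le ht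
    exact Or.inr ⟨s, rfl, concat_apply_add h s⟩

lemma IsDissipative.concat {a : ℝ≥0} (hu : IsDissipative φ g u) (hv : IsDissipative φ g v)
    (h : v 0 = u a) : IsDissipative φ g (concat a u v) := hu.concatenation hv h

/-- `v` reaches `p` at time `t` along the range of `y`. -/
def ReachesAt (φ : S → EReal) (g : S → ℝ≥0∞) (y : ℝ≥0 → S) (p : S) (t : ℝ≥0) (v : ℝ≥0 → S) : Prop :=
  IsDissipative φ g v ∧ v 0 = y 0 ∧ range v ⊆ range y ∧ v t = p

/-- The least time at which a solution running in the range of `y` from `y 0` reaches `p`. -/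
def reachTime (φ : S → EReal) (g : S → ℝ≥0∞) (y : ℝ≥0 → S) (p : S) : ℝ≥0 :=
  sInf {t | ∃ v, ReachesAt φ g y p t v}

lemma reachTime_le {p : S} {t : ℝ≥0} (h : ReachesAt φ g y p t v) : reachTime φ g y p ≤ t :=
  csInf_le' ⟨v, h⟩

/-- The least time is attained. In a minimizing sequence each solution may be continued by `y` once
it has reached `p`, which puts the sequence into compact pieces of the range of `y`. -/
lemma exists_reachesAt_reachTime (hA : IsAdmissible φ g) (hy : IsDissipative φ g y) {p : S}
    (hp : p ∈ range y) : ∃ v, ReachesAt φ g y p (reachTime φ g y p) v := by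
  obtain ⟨r, rfl⟩ := hp
  have hne : {t | ∃ v, ReachesAt φ g y (y r) t v}.Nonempty := ⟨r, y, hy, rfl, Subset.rfl, rfl⟩
  obtain ⟨t, -, htlim, htm⟩ := exists_seq_tendsto_sInf hne (OrderBot.bddBelow _)
  choose v hv using htm
  -- The optimal curve is a limit of the solutions `v n`, each continued by `y` from time `t n`.
  set Y : ℝ≥0 → S := fun s => y (s + r) with hY
  have h0 : ∀ n, Y 0 = v n (t n) := fun n => by simp only [hY, zero_add, (hv n).2.2.2]
  obtain ⟨w, hw, hwm, k, hk, hlim⟩ := exists_subseq_tendsto_of_mem_image hA.lsc_slope hy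
    (hA.continuous_energy y hy) (U := fun n => concat (t n) (v n) Y) (c := fun s => s + r)
    (fun n => (hv n).1.concat (hy.translation r) (h0 n)) (fun n s => by
      rcases concat_cases (h0 n) s with ⟨hs, he⟩ | ⟨a, ha, he⟩
      · simp only [he]
        refine image_mono (Icc_subset_Icc_right le_add_self)
          (hy.mem_image_Icc_of_energy_le ((hv n).2.2.1 (mem_range_self s)) ?_)
        have := (hv n).1.energy_antitone hs
        simpa only [energy, (hv n).2.2.2] using this
      · simp only [he]
        refine ⟨a + r, ⟨zero_le, ?_⟩, rfl⟩
        rw [ha]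
        gcongr
        exact le_add_self)
  refine ⟨w, hw, ?_, ?_, ?_⟩
  · refine tendsto_nhds_unique (hlim (fun _ => 0) 0 tendsto_const_nhds) ?_
    simp only [concat_apply_of_le (zero_le : (0 : ℝ≥0) ≤ _), (hv _).2.1]
    exact tendsto_const_nhds
  · rintro _ ⟨s, rfl⟩
    exact image_subset_range _ _ (hwm s)
  · refine tendsto_nhds_unique (hlim (fun n => t (k n)) _ (htlim.comp hk.tendsto_atTop)) ?_
    simp only [concat_apply_of_le le_rfl, (hv _).2.2.2]
    exact tendsto_const_nhds

/-- Following `v` inside the range of `y` takes at least the difference of the least times. -/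
lemma reachTime_le_add (hA : IsAdmissible φ g) (hy : IsDissipative φ g y)
    (hv : IsDissipative φ g v) {s t : ℝ≥0} (hst : s ≤ t) (hsub : ∀ r ∈ Icc s t, v r ∈ range y) :
    reachTime φ g y (v t) ≤ reachTime φ g y (v s) + (t - s) := by
  obtain ⟨w, hw, hw0, hwr, hwe⟩ := exists_reachesAt_reachTime hA hy (hsub s ⟨le_rfl, hst⟩)
  obtain ⟨r, hr⟩ := hsub t ⟨hst, le_rfl⟩
  have e1 : y (0 + r) = v (t - s + s) := by rw [zero_add, hr, tsub_add_cancel_of_le hst]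
  -- After `v t` the curve continues along `y`, so that it never leaves the range of `y`.
  set a := concat (t - s) (fun σ => v (σ + s)) (fun σ => y (σ + r)) with ha
  have ha' : IsDissipative φ g a := (hv.translation s).concat (hy.translation r) e1
  have ha0 : a 0 = w (reachTime φ g y (v s)) := by
    rw [ha, concat_apply_of_le zero_le, hwe, zero_add]
  refine reachTime_le (v := concat (reachTime φ g y (v s)) w a)
    ⟨hw.concat ha' ha0, ?_, ?_, ?_⟩
  · rw [concat_apply_of_le zero_le, hw0]
  · rintro _ ⟨σ, rfl⟩
    rcases concat_cases ha0 σ with ⟨-, he⟩ | ⟨σ', -, he⟩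
    · rw [he]; exact hwr (mem_range_self _)
    · rw [he]
      rcases concat_cases (u := fun σ => v (σ + s)) (v := fun σ => y (σ + r)) e1 σ' with
        ⟨hσ, he'⟩ | ⟨σ'', -, he'⟩
      · rw [ha, he']
        exact hsub _ ⟨le_add_self, (add_le_add_left hσ s).trans_eq (tsub_add_cancel_of_le hst)⟩
      · rw [ha, he']; exact mem_range_self _
  · rw [concat_apply_add ha0, ha, concat_apply_of_le le_rfl, tsub_add_cancel_of_le hst]

/-- A solution which is optimal for `p` is optimal for every point which it passes before. -/
lemma reachTime_apply_of_le (hA : IsAdmissible φ g) (hy : IsDissipative φ g y) {p : S}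
    (h : ReachesAt φ g y p (reachTime φ g y p) v) {t : ℝ≥0} (ht : t ≤ reachTime φ g y p) :
    reachTime φ g y (v t) = t := by
  have hr : ∀ s, v s ∈ range y := fun s => h.2.2.1 (mem_range_self s)
  refine le_antisymm (reachTime_le ⟨h.1, h.2.1, h.2.2.1, rfl⟩) ?_
  have h1 := reachTime_le_add hA hy h.1 ht fun r _ => hr r
  rw [h.2.2.2] at h1
  by_contra! hlt
  have h2 : reachTime φ g y p < t + (reachTime φ g y p - t) := h1.trans_lt (by gcongr)
  rw [add_tsub_cancel_of_le ht] at h2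
  exact lt_irrefl _ h2

/-- The optimal solutions for two points are consistent: the one for the point of lower energy
passes the other point, at the least possible time. -/
lemma reachTime_mono (hA : IsAdmissible φ g) (hy : IsDissipative φ g y) {p q : S}
    (h : ReachesAt φ g y p (reachTime φ g y p) v) (hq : q ∈ range y)
    (hpq : (φ p).toReal ≤ (φ q).toReal) :
    reachTime φ g y q ≤ reachTime φ g y p ∧ v (reachTime φ g y q) = q := by
  have hc := hA.continuous_energy v h.1
  have hq0 : (φ q).toReal ≤ energy φ v 0 := by
    obtain ⟨r, rfl⟩ := hq
    have := hy.energy_antitone (zero_le : 0 ≤ r)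
    simpa only [energy, h.2.1] using this
  have hqp : energy φ v (reachTime φ g y p) ≤ (φ q).toReal := by
    simpa only [energy, h.2.2.2] using hpq
  obtain ⟨s, hs, hse⟩ := intermediate_value_Icc' (zero_le : 0 ≤ reachTime φ g y p)
    hc.continuousOn ⟨hqp, hq0⟩
  have hsq : v s = q := hy.injOn_toReal_range (h.2.2.1 (mem_range_self s)) hq hse
  have h2 := reachTime_apply_of_le hA hy h hs.2
  rw [hsq] at h2
  rw [h2]
  exact ⟨hs.2, hsq⟩

lemma reachTime_injOn (hA : IsAdmissible φ g) (hy : IsDissipative φ g y) :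
    InjOn (reachTime φ g y) (range y) := by
  intro p hp q hq hpq
  wlog h : (φ p).toReal ≤ (φ q).toReal generalizing p q
  · exact (this hq hp hpq.symm (le_of_not_ge h)).symm
  obtain ⟨v, hv⟩ := exists_reachesAt_reachTime hA hy hp
  rw [← hv.2.2.2, hpq]
  exact (reachTime_mono hA hy hv hq h).2

/-- There is a solution which passes every point of the range of `y` at the least possible time. If
the range has no point of least energy, the solution is assembled from the optimal solutions for its
points; if moreover the least times are bounded, it is continued by the limit of `y`. -/
theorem exists_apply_reachTime_eq [CompleteSpace S] (hA : IsAdmissible φ g)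
    (hy : IsDissipative φ g y) :
    ∃ u ∈ solutionsOnRange (dissipativeCurves φ g) y, ∀ q ∈ range y, u (reachTime φ g y q) = q := by
  set τ := reachTime φ g y with hτ
  suffices h : ∃ u, IsDissipative φ g u ∧ range u ⊆ closure (range y) ∧
      ∀ q ∈ range y, u (τ q) = q by
    obtain ⟨u, hu, h1, h2⟩ := h
    exact ⟨u, (mem_solutionsOnRange_iff hA hy).2 ⟨hu, fun q hq => ⟨τ q, h2 q hq⟩, h1⟩, h2⟩
  by_cases hmin : ∃ r, ∀ s, energy φ y r ≤ energy φ y s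
  · obtain ⟨r, hr⟩ := hmin
    obtain ⟨v, hv⟩ := exists_reachesAt_reachTime hA hy (mem_range_self r)
    refine ⟨v, hv.1, hv.2.2.1.trans subset_closure, fun q hq => ?_⟩
    refine (reachTime_mono hA hy hv hq ?_).2
    obtain ⟨s, rfl⟩ := hq
    exact hr s
  push Not at hmin
  obtain ⟨w, hw⟩ : ∃ w : ℝ≥0 → S, ∀ p ∈ range y, w (τ p) = p := by
    have : Nonempty S := ⟨y 0⟩
    exact ⟨Function.invFunOn τ (range y), (reachTime_injOn hA hy).leftInvOn_invFunOn⟩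
  have hagree : ∀ p ∈ range y, ∃ v, ReachesAt φ g y p (τ p) v ∧ ∀ t ≤ τ p, v t = w t := by
    intro p hp
    obtain ⟨v, hv⟩ := exists_reachesAt_reachTime hA hy hp
    refine ⟨v, hv, fun t ht => ?_⟩
    have h1 := reachTime_apply_of_le hA hy hv ht
    have h2 := hw (v t) (hv.2.2.1 (mem_range_self t))
    rw [hτ, h1] at h2
    exact h2.symm
  have hlt : ∀ p ∈ range y, ∃ q ∈ range y, τ p < τ q := by
    rintro _ ⟨r, rfl⟩
    obtain ⟨s, hs⟩ := hmin r
    obtain ⟨v, hv⟩ := exists_reachesAt_reachTime hA hy (mem_range_self s)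
    refine ⟨y s, mem_range_self s, lt_of_le_of_ne
      (reachTime_mono hA hy hv (mem_range_self r) hs.le).1 fun h => ?_⟩
    have h3 := reachTime_injOn hA hy (mem_range_self r) (mem_range_self s) h
    simp only [energy, h3, lt_irrefl] at hs
  by_cases hb : BddAbove (τ '' range y)
  · set θ := sSup (τ '' range y) with hθ
    have hτθ : ∀ p ∈ range y, τ p < θ := fun p hp => by
      obtain ⟨q, hq, hpq⟩ := hlt p hp
      exact hpq.trans_le (le_csSup hb (mem_image_of_mem _ hq))
    have hex : ∀ T < θ, ∃ p ∈ range y, T < τ p := fun T hT => by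
      obtain ⟨_, ⟨p, hp, rfl⟩, hpT⟩ := exists_lt_of_lt_csSup
        ((range_nonempty y).image τ) hT
      exact ⟨p, hp, hpT⟩
    have himg : w '' Iio θ = range y := by
      refine Subset.antisymm ?_ fun p hp => ⟨τ p, hτθ p hp, hw p hp⟩
      rintro _ ⟨t, ht, rfl⟩
      obtain ⟨p, hp, hpt⟩ := hex t ht
      obtain ⟨v, hv, hvw⟩ := hagree p hp
      rw [← hvw t hpt.le]
      exact hv.2.2.1 (mem_range_self t)
    obtain ⟨A, B, hB, x₀, hq⟩ := hA.quadratic_bound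
    obtain ⟨x, hx, -, hux⟩ := isDissipative_extension hA.ne_bot hA.lsc_energy hA.lsc_slope hB hq hy
      (w := w) (θ := θ) (fun T hT => by
        obtain ⟨p, hp, hpT⟩ := hex T hT
        obtain ⟨v, hv, hvw⟩ := hagree p hp
        exact ⟨v, hv.1, fun t ht => hvw t (ht.trans hpT.le)⟩) himg
    refine ⟨_, hux, ?_, fun q hq => ?_⟩
    · rintro _ ⟨t, rfl⟩
      rcases lt_or_ge t θ with ht | ht
      · simp only [if_pos ht]
        exact subset_closure (himg ▸ mem_image_of_mem w ht)
      · simp only [if_neg (not_lt.2 ht)]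
        exact mem_closure_of_tendsto hx (Eventually.of_forall fun n => mem_range_self _)
    · simp only [if_pos (hτθ q hq), hw q hq]
  · have hex : ∀ T, ∃ p ∈ range y, T < τ p := fun T => by
      obtain ⟨_, ⟨p, hp, rfl⟩, hpT⟩ := not_bddAbove_iff.1 hb T
      exact ⟨p, hp, hpT⟩
    refine ⟨w, isDissipative_of_forall_Icc fun T _ => ?_, ?_, hw⟩
    · obtain ⟨p, hp, hpT⟩ := hex T
      obtain ⟨v, hv, hvw⟩ := hagree p hp
      exact ⟨v, hv.1, fun t ht => hvw t (ht.trans hpT.le)⟩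
    · rintro _ ⟨t, rfl⟩
      obtain ⟨p, hp, hpT⟩ := hex t
      obtain ⟨v, hv, hvw⟩ := hagree p hp
      rw [← hvw t hpT.le]
      exact subset_closure (hv.2.2.1 (mem_range_self t))

end

section

variable {S : Type*} [MetricSpace S] {φ : S → EReal} {g : S → ℝ≥0∞} {u v w y : ℝ≥0 → S}

/-! ### Minimal solutions -/

lemma lipschitzWith_one_of_le_add {z : ℝ≥0 → ℝ≥0} (hz : Monotone z)
    (h : ∀ s t : ℝ≥0, s ≤ t → z t ≤ z s + (t - s)) : LipschitzWith 1 z := by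
  refine LipschitzWith.of_dist_le_mul fun s t => ?_
  wlog hst : s ≤ t generalizing s t
  · rw [dist_comm, dist_comm s]; exact this t s (le_of_not_ge hst)
  have h1 := NNReal.coe_le_coe.2 (h s t hst)
  have h2 : (z s : ℝ) ≤ z t := hz hst
  have h3 : (s : ℝ) ≤ t := hst
  push_cast [NNReal.coe_sub hst] at h1
  rw [dist_comm, dist_comm s, NNReal.dist_eq, NNReal.dist_eq, abs_of_nonneg (sub_nonneg.2 h2),
    abs_of_nonneg (sub_nonneg.2 h3), NNReal.coe_one, one_mul]
  linarith

lemma Succeeds.exists_le (h : Succeeds u v) :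
    ∃ z : ℝ≥0 → ℝ≥0, Monotone z ∧ (∀ t, z t ≤ t) ∧ ∀ t, u t = v (z t) := by
  obtain ⟨-, z, hz, hzl, hz0, hzu⟩ := h
  refine ⟨z, hz, fun t => ?_, hzu⟩
  have := hzl.dist_le_mul t 0
  rw [hz0, NNReal.dist_eq, NNReal.dist_eq] at this
  simpa using this

lemma Succeeds.antisymm (hv : IsDissipative φ g v) (hu : IsDissipative φ g u)
    (h : Succeeds u v) (h' : Succeeds v u) : u = v := by
  obtain ⟨z, -, hz, hzu⟩ := h.exists_le
  obtain ⟨z', -, hz', hzv⟩ := h'.exists_le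
  funext t
  have h1 : energy φ u t = energy φ v (z t) := by simp only [energy, hzu]
  have h2 : energy φ v t = energy φ u (z' t) := by simp only [energy, hzv]
  have h3 := hu.energy_antitone (hz' t)
  have h4 := hv.energy_antitone (hz t)
  rw [hzu t]
  exact hv.eq_of_energy_eq (by linarith)

lemma Succeeds.mem_solutionsOnRange (hA : IsAdmissible φ g) (hy : IsDissipative φ g y)
    (hu : u ∈ solutionsOnRange (dissipativeCurves φ g) y) (hv : IsDissipative φ g v)
    (h : Succeeds u v) : v ∈ solutionsOnRange (dissipativeCurves φ g) y := by
  obtain ⟨hud, h1, h2⟩ := (mem_solutionsOnRange_iff hA hy).1 hu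
  obtain ⟨h3, z, -, -, -, hz⟩ := h
  rw [rangeClosure_eq_closure hud.continuous] at h3
  refine (mem_solutionsOnRange_iff hA hy).2 ⟨hv, h1.trans ?_, h3.trans ?_⟩
  · rintro _ ⟨t, rfl⟩
    exact ⟨z t, (hz t).symm⟩
  · exact closure_minimal h2 isClosed_closure

/-- If `u` passes every point of the range of `y` at the least possible time, then every solution
`v` on this range is a delayed version of `u`: at time `t` it has reached the point at which `u` is at
the largest of the least times of the points passed by `v` up to `t`. -/
lemma succeeds_of_apply_reachTime_eq [CompleteSpace S] (hA : IsAdmissible φ g)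
    (hy : IsDissipative φ g y) (hu : u ∈ solutionsOnRange (dissipativeCurves φ g) y)
    (huτ : ∀ q ∈ range y, u (reachTime φ g y q) = q)
    (hv : v ∈ solutionsOnRange (dissipativeCurves φ g) y) : Succeeds v u := by
  obtain ⟨hud, -, hu2⟩ := (mem_solutionsOnRange_iff hA hy).1 hu
  obtain ⟨hvd, hv1, hv2⟩ := (mem_solutionsOnRange_iff hA hy).1 hv
  obtain ⟨θ, hθ, hin, hout⟩ := hv.2.2.2
  rw [rangeClosure_eq_closure hy.continuous] at hout
  have hmem : ∀ s : ℝ≥0, (s : ℝ≥0∞) < θ → v s ∈ range y := fun s hs => hin ▸ mem_image_of_mem v hs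
  have hv0 := hy.apply_zero_eq hA hvd hv1 hv2
  set τ := reachTime φ g y with hτ
  set Z : ℝ≥0 → Set ℝ≥0 := fun t => {a | ∃ s : ℝ≥0, s ≤ t ∧ (s : ℝ≥0∞) < θ ∧ a = τ (v s)} with hZ
  have hadd : ∀ s t : ℝ≥0, s ≤ t → (t : ℝ≥0∞) < θ → τ (v t) ≤ τ (v s) + (t - s) :=
    fun s t hst ht => reachTime_le_add hA hy hvd hst fun r hr =>
      hmem r ((ENNReal.coe_le_coe.2 hr.2).trans_lt ht)
  have hτ0 : τ (v 0) = 0 := by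
    rw [hv0]
    exact le_antisymm (reachTime_le ⟨hy, rfl, Subset.rfl, rfl⟩) zero_le
  have hle : ∀ s : ℝ≥0, (s : ℝ≥0∞) < θ → τ (v s) ≤ s := fun s hs => by
    simpa [hτ0] using hadd 0 s zero_le hs
  have hZne : ∀ t, (Z t).Nonempty := fun t => ⟨τ (v 0), 0, zero_le, by simpa using hθ, rfl⟩
  have hZle : ∀ t, ∀ a ∈ Z t, a ≤ t := by
    rintro t _ ⟨s, hst, hs, rfl⟩
    exact (hle s hs).trans hst
  have hZbdd : ∀ t, BddAbove (Z t) := fun t => ⟨t, hZle t⟩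
  set z : ℝ≥0 → ℝ≥0 := fun t => sSup (Z t) with hz
  have hzmono : Monotone z := fun s t hst => csSup_le_csSup (hZbdd t) (hZne s) (by
    rintro _ ⟨r, hr, hrθ, rfl⟩
    exact ⟨r, hr.trans hst, hrθ, rfl⟩)
  have hzlip : LipschitzWith 1 z := by
    refine lipschitzWith_one_of_le_add hzmono fun s t hst => csSup_le (hZne t) ?_
    rintro _ ⟨r, hr, hrθ, rfl⟩
    rcases le_total r s with hrs | hsr
    · exact (le_csSup (hZbdd s) ⟨r, hrs, hrθ, rfl⟩).trans le_self_add
    · refine (hadd s r hsr hrθ).trans (add_le_add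
        (le_csSup (hZbdd s) ⟨s, le_rfl, (ENNReal.coe_le_coe.2 hsr).trans_lt hrθ, rfl⟩)
        (tsub_le_tsub_right hr s))
  have hτmono : ∀ s t : ℝ≥0, s ≤ t → (t : ℝ≥0∞) < θ → τ (v s) ≤ τ (v t) := fun s t hst ht => by
    obtain ⟨x, hx⟩ := exists_reachesAt_reachTime hA hy (hmem t ht)
    exact (reachTime_mono hA hy hx (hmem s ((ENNReal.coe_le_coe.2 hst).trans_lt ht))
      (hvd.energy_antitone hst)).1
  have hzin : ∀ t : ℝ≥0, (t : ℝ≥0∞) < θ → v t = u (z t) := fun t ht => by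
    have : z t = τ (v t) := by
      refine le_antisymm (csSup_le (hZne t) ?_) (le_csSup (hZbdd t) ⟨t, le_rfl, ht, rfl⟩)
      rintro _ ⟨r, hr, -, rfl⟩
      exact hτmono r t hr ht
    rw [this, huτ _ (hmem t ht)]
  refine ⟨?_, z, hzmono, hzlip, ?_, fun t => ?_⟩
  · rw [rangeClosure_eq_closure hvd.continuous]
    exact hu2.trans (closure_mono hv1)
  · exact le_antisymm (csSup_le (hZne 0) (hZle 0)) zero_le
  rcases lt_or_ge (t : ℝ≥0∞) θ with ht | ht
  · exact hzin t ht
  lift θ to ℝ≥0 using (ht.trans_lt ENNReal.coe_lt_top).ne with c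
  simp only [ENNReal.coe_lt_coe, ENNReal.coe_le_coe] at hin hout hzin ht
  have hc0 : 0 < c := by exact_mod_cast hθ
  have h1 : v t = v c := eq_of_notMem_range hA hy hvd hin hout ht
  have h2 : z t = z c := by
    simp only [hz, hZ, ENNReal.coe_lt_coe]
    congr 1
    ext a
    constructor
    · rintro ⟨s, -, hs, rfl⟩; exact ⟨s, hs.le, hs, rfl⟩
    · rintro ⟨s, -, hs, rfl⟩; exact ⟨s, hs.le.trans ht, hs, rfl⟩
  rw [h1, h2]
  have : NeBot (𝓝[<] c) := nhdsLT_neBot_of_exists_lt ⟨0, hc0⟩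
  refine tendsto_nhds_unique
    ((hvd.continuous.tendsto c).mono_left (nhdsWithin_le_nhds (s := Iio c)))
    (Tendsto.congr' ?_ (((hud.continuous.comp hzlip.continuous).tendsto c).mono_left
      (nhdsWithin_le_nhds (s := Iio c))))
  filter_upwards [self_mem_nhdsWithin] with s hs
  exact (hzin s hs).symm

theorem exists_minimalSolution [CompleteSpace S] (hA : IsAdmissible φ g)
    (hy : IsDissipative φ g y) :
    ∃ u ∈ solutionsOnRange (dissipativeCurves φ g) y ∩ minimalSolutions (dissipativeCurves φ g),
      ∀ v ∈ solutionsOnRange (dissipativeCurves φ g) y, Succeeds v u := by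
  obtain ⟨u, hu, huτ⟩ := exists_apply_reachTime_eq hA hy
  refine ⟨u, ⟨hu, hu.1, fun v hv huv => ?_⟩, fun v hv =>
    succeeds_of_apply_reachTime_eq hA hy hu huτ hv⟩
  exact huv.antisymm hv hu.1 (succeeds_of_apply_reachTime_eq hA hy hu huτ
    (huv.mem_solutionsOnRange hA hy hu hv))

lemma succeeds_of_mem_minimalSolutions [CompleteSpace S] (hA : IsAdmissible φ g)
    (hy : IsDissipative φ g y) (hu : u ∈ minimalSolutions (dissipativeCurves φ g))
    (huy : u ∈ solutionsOnRange (dissipativeCurves φ g) y)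
    (hv : v ∈ solutionsOnRange (dissipativeCurves φ g) y) : Succeeds v u := by
  obtain ⟨u', hu', h⟩ := exists_minimalSolution hA hy
  rw [hu.2 u' hu'.2.1 (h u huy)]
  exact h v hv

/-! ### Rest times -/

lemma restTime_le {X : Type*} {u : ℝ≥0 → X} {s : ℝ≥0} (h : ∀ t, s ≤ t → u t = u s) :
    restTime u ≤ s := sInf_le ⟨s, rfl, h⟩

lemma exists_rest_of_restTime_lt {X : Type*} {u : ℝ≥0 → X} {a : ℝ≥0∞} (h : restTime u < a) :
    ∃ s : ℝ≥0, (s : ℝ≥0∞) < a ∧ ∀ t, s ≤ t → u t = u s := by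
  obtain ⟨_, ⟨s, rfl, hs⟩, hsa⟩ := sInf_lt_iff.1 h
  exact ⟨s, hsa, hs⟩

/-- The infimum in the definition of the rest time of a continuous curve is attained. -/
lemma eq_of_restTime_le {X : Type*} [TopologicalSpace X] [T2Space X] {u : ℝ≥0 → X}
    (hu : Continuous u) {ρ : ℝ≥0} (h : restTime u = ρ) {t : ℝ≥0} (ht : ρ ≤ t) : u t = u ρ := by
  have key : ∀ s, ρ < s → u s = u (t + 1) := by
    intro s hs
    obtain ⟨a, ha, hau⟩ := exists_rest_of_restTime_lt (h.trans_lt (ENNReal.coe_lt_coe.2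
      (lt_min hs (ht.trans_lt (lt_add_one t)))))
    have ha' := ENNReal.coe_lt_coe.1 ha
    rw [hau s (ha'.le.trans (min_le_left _ _)), hau (t + 1) (ha'.le.trans (min_le_right _ _))]
  have hρ : u ρ = u (t + 1) := by
    refine tendsto_nhds_unique ((hu.tendsto ρ).mono_left (nhdsWithin_le_nhds (s := Ioi ρ)))
      (tendsto_const_nhds.congr' ?_)
    filter_upwards [self_mem_nhdsWithin] with s hs
    exact (key s hs).symm
  rcases ht.eq_or_lt with rfl | hlt
  · rfl
  · rw [key t hlt, hρ]

/-- A minimal solution has no plateau before it comes to rest: cutting out a plateau would give a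
faster solution with the same range. -/
lemma injOn_of_mem_minimalSolutions (hu : u ∈ minimalSolutions (dissipativeCurves φ g)) :
    InjOn u {t : ℝ≥0 | (t : ℝ≥0∞) < restTime u} := by
  have hud : IsDissipative φ g u := hu.1
  intro s hs t ht hst
  by_contra hne
  wlog hlt : s < t generalizing s t
  · exact this ht hs hst.symm (Ne.symm hne) (lt_of_le_of_ne (le_of_not_gt hlt) (Ne.symm hne))
  obtain ⟨d, rfl⟩ := exists_add_of_le hlt.le
  have hd : 0 < d := by simpa using hlt
  have h0 : (fun r => u (r + (s + d))) 0 = u s := by simp only [zero_add]; exact hst.symm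
  set v := concat s u (fun r => u (r + (s + d))) with hv
  have hvd : IsDissipative φ g v := hud.concat (hud.translation (s + d)) h0
  have hsucc : Succeeds u v := by
    -- The change of time rests at `s` during the plateau `[s, s + d]`.
    refine ⟨?_, fun r => max (min r s) (r - d), ?_, ?_, by simp, fun r => ?_⟩
    · refine Subset.trans ?_ subset_union_left
      rintro _ ⟨r, rfl⟩
      rcases concat_cases (u := u) (v := fun r => u (r + (s + d))) h0 r with ⟨-, he⟩ | ⟨r', -, he⟩
      · rw [hv, he]; exact mem_range_self _
      · rw [hv, he]; exact mem_range_self _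
    · intro a b hab
      exact max_le_max (min_le_min_right s hab) (tsub_le_tsub_right hab d)
    · refine lipschitzWith_one_of_le_add
        (fun a b hab => max_le_max (min_le_min_right s hab) (tsub_le_tsub_right hab d))
        fun a b hab => max_le ?_ ?_
      · rcases le_total a s with h | h
        · calc min b s ≤ b := min_le_left _ _
            _ = min a s + (b - a) := by rw [min_eq_left h, add_tsub_cancel_of_le hab]
            _ ≤ _ := by gcongr; exact le_max_left _ _
        · calc min b s ≤ s := min_le_right _ _
            _ = min a s := (min_eq_right h).symm
            _ ≤ _ := (le_max_left _ _).trans le_self_add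
      · calc b - d = (a + (b - a)) - d := by rw [add_tsub_cancel_of_le hab]
          _ ≤ (a - d) + (b - a) := by
            rw [tsub_le_iff_right, add_right_comm]
            gcongr
            exact le_tsub_add
          _ ≤ _ := by gcongr; exact le_max_right _ _
    · change u r = v (max (min r s) (r - d))
      rcases le_total r s with hr | hr
      · rw [min_eq_left hr, max_eq_left tsub_le_self, hv, concat_apply_of_le hr]
      rw [min_eq_right hr]
      rcases le_total r (s + d) with hr' | hr'
      · rw [max_eq_left (tsub_le_iff_right.2 hr'), hv, concat_apply_of_le le_rfl,
          hud.eq_of_mem_Icc hst ⟨hr, hr'⟩, hst]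
      · obtain ⟨a, rfl⟩ := exists_add_of_le hr'
        have e1 : s + d + a - d = s + a := by
          rw [add_right_comm, add_tsub_cancel_right]
        rw [e1, max_eq_right le_self_add, hv, concat_apply_add h0, add_comm a]
  have huv := hu.2 v hvd hsucc
  have hper : ∀ r, u (s + r) = u (r + (s + d)) := fun r => by
    conv_lhs => rw [huv, hv, concat_apply_add h0]
  have hn : ∀ n : ℕ, u (s + n * d) = u s := by
    intro n
    induction n with
    | zero => simp
    | succ n ih =>
      have e : (s + ((n + 1 : ℕ) : ℝ≥0) * d) = n * d + (s + d) := by push_cast; ring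
      rw [e, ← hper, ih]
  have hrest : ∀ r, s ≤ r → u r = u s := by
    intro r hr
    obtain ⟨n, hnr⟩ := Archimedean.arch r hd
    have h3 : r ≤ s + n * d := by
      rw [nsmul_eq_mul] at hnr
      exact hnr.trans le_add_self
    rw [hud.eq_of_mem_Icc (hn n).symm ⟨hr, h3⟩, hn n]
  exact absurd (restTime_le hrest) (not_le.2 hs)

lemma min_restTime_le_of_mem_minimalSolutions [CompleteSpace S] (hA : IsAdmissible φ g)
    (hu : u ∈ minimalSolutions (dissipativeCurves φ g)) (hv : IsDissipative φ g v)
    (huv : u ∈ solutionsOnRange (dissipativeCurves φ g) v) {t₀ t₁ : ℝ≥0} (h : u t₀ = v t₁) :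
    min (t₀ : ℝ≥0∞) (restTime u) ≤ t₁ := by
  have hud : IsDissipative φ g u := hu.1
  obtain ⟨z, -, hz, hzv⟩ := (succeeds_of_mem_minimalSolutions hA hv hu huv
    (self_mem_solutionsOnRange hA hv)).exists_le
  by_contra! hlt
  have h1 : ((z t₁ : ℝ≥0) : ℝ≥0∞) < min (t₀ : ℝ≥0∞) (restTime u) :=
    (ENNReal.coe_le_coe.2 (hz t₁)).trans_lt hlt
  obtain ⟨a, ha1, ha2⟩ := ENNReal.lt_iff_exists_nnreal_btwn.1 h1
  have hza := ENNReal.coe_lt_coe.1 ha1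
  have hat := ENNReal.coe_lt_coe.1 (lt_min_iff.1 ha2).1
  have h2 : u (z t₁) = u t₀ := by rw [h, hzv]
  have h3 : u a = u (z t₁) := by rw [hud.eq_of_mem_Icc h2 ⟨hza.le, hat.le⟩, h2]
  exact hza.ne' (injOn_of_mem_minimalSolutions hu (lt_min_iff.1 ha2).2 (lt_min_iff.1 h1).2 h3)

/-- Two solutions with a common piece of their ranges run through it in the same direction. -/
lemma apply_eq_of_image_Icc_eq (hu : IsDissipative φ g u) (hv : IsDissipative φ g v)
    {a b c d : ℝ≥0} (hab : a ≤ b) (hcd : c ≤ d) (h : u '' Icc a b = v '' Icc c d) :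
    u a = v c ∧ u b = v d := by
  have h1 : ∀ s ∈ Icc a b, ∃ t ∈ Icc c d, v t = u s := fun s hs =>
    (h ▸ mem_image_of_mem u hs : u s ∈ v '' Icc c d)
  have h2 : ∀ t ∈ Icc c d, ∃ s ∈ Icc a b, u s = v t := fun t ht =>
    (h.symm ▸ mem_image_of_mem v ht : v t ∈ u '' Icc a b)
  constructor
  · obtain ⟨t, ht, hta⟩ := h1 a ⟨le_rfl, hab⟩
    obtain ⟨s, hs, hsc⟩ := h2 c ⟨le_rfl, hcd⟩
    have e1 := hv.energy_antitone ht.1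
    have e2 := hu.energy_antitone hs.1
    simp only [energy, hta, hsc] at e1 e2
    rw [← hta]
    exact hv.eq_of_energy_eq (le_antisymm (by simpa only [energy, hta] using e1)
      (by simpa only [energy, hta] using e2))
  · obtain ⟨t, ht, htb⟩ := h1 b ⟨hab, le_rfl⟩
    obtain ⟨s, hs, hsd⟩ := h2 d ⟨hcd, le_rfl⟩
    have e1 := hv.energy_antitone ht.2
    have e2 := hu.energy_antitone hs.2
    simp only [energy, htb, hsd] at e1 e2
    rw [← htb]
    exact hv.eq_of_energy_eq (le_antisymm (by simpa only [energy, htb] using e2)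
      (by simpa only [energy, htb] using e1))

/-- A piece of a minimal solution may be replaced by any solution running through the same points,
so it cannot be run through faster. -/
lemma min_restTime_sub_le_of_image_eq [CompleteSpace S] (hA : IsAdmissible φ g)
    (hu : u ∈ minimalSolutions (dissipativeCurves φ g)) (hv : IsDissipative φ g v)
    {s₀ t₀ s₁ t₁ : ℝ≥0} (h₀ : s₀ ≤ t₀) (h₁ : s₁ ≤ t₁) (h : v '' Icc s₁ t₁ = u '' Icc s₀ t₀) :
    (min (t₀ : ℝ≥0∞) (restTime u)).toReal - (s₀ : ℝ) ≤ (t₁ : ℝ) - (s₁ : ℝ) := by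
  have hud : IsDissipative φ g u := hu.1
  obtain ⟨hs, ht⟩ := apply_eq_of_image_Icc_eq hv hud h₁ h₀ h
  have e1 : (fun r => u (r + t₀)) 0 = (fun r => v (r + s₁)) (t₁ - s₁) := by
    simp only [zero_add, tsub_add_cancel_of_le h₁, ht]
  set a := concat (t₁ - s₁) (fun r => v (r + s₁)) (fun r => u (r + t₀)) with ha
  have had : IsDissipative φ g a := (hv.translation s₁).concat (hud.translation t₀) e1
  have e2 : a 0 = u s₀ := by rw [ha, concat_apply_of_le zero_le, zero_add, hs]
  set b := concat s₀ u a with hb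
  have hbd : IsDissipative φ g b := hud.concat had e2
  have hbt : b (s₀ + (t₁ - s₁)) = u t₀ := by
    rw [hb, concat_apply_add e2, ha, concat_apply_of_le le_rfl, tsub_add_cancel_of_le h₁, ht]
  have hba : ∀ r, b (s₀ + (t₁ - s₁ + r)) = u (r + t₀) := fun r => by
    rw [hb, concat_apply_add e2, ha, concat_apply_add e1]
  have hrange : range b = range u := by
    apply Subset.antisymm
    · rintro _ ⟨r, rfl⟩
      rcases concat_cases e2 r with ⟨-, he⟩ | ⟨r', -, he⟩
      · rw [hb, he]; exact mem_range_self _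
      rw [hb, he]
      rcases concat_cases (u := fun r => v (r + s₁)) (v := fun r => u (r + t₀)) e1 r' with
        ⟨hr, he'⟩ | ⟨r'', -, he'⟩
      · rw [ha, he']
        exact image_subset_range u (Icc s₀ t₀) (h ▸ mem_image_of_mem v
          ⟨le_add_self, (add_le_add_left hr s₁).trans_eq (tsub_add_cancel_of_le h₁)⟩)
      · rw [ha, he']; exact mem_range_self _
    · rintro _ ⟨r, rfl⟩
      rcases le_total r s₀ with hr | hr
      · exact ⟨r, concat_apply_of_le hr⟩
      rcases le_total r t₀ with hr' | hr'
      · obtain ⟨σ, hσ, hσr⟩ : u r ∈ v '' Icc s₁ t₁ := h.symm ▸ mem_image_of_mem u ⟨hr, hr'⟩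
        refine ⟨s₀ + (σ - s₁), ?_⟩
        rw [hb, concat_apply_add e2, ha, concat_apply_of_le (tsub_le_tsub_right hσ.2 _),
          tsub_add_cancel_of_le hσ.1, hσr]
      · refine ⟨s₀ + (t₁ - s₁ + (r - t₀)), ?_⟩
        rw [hba, tsub_add_cancel_of_le hr']
  have hub : u ∈ solutionsOnRange (dissipativeCurves φ g) b :=
    (mem_solutionsOnRange_iff hA hbd).2 ⟨hud, hrange.le, hrange ▸ subset_closure⟩
  have h3 := min_restTime_le_of_mem_minimalSolutions hA hu hbd hub hbt.symm
  have h4 := ENNReal.toReal_mono ENNReal.coe_ne_top h3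
  rw [ENNReal.coe_toReal] at h4
  push_cast [NNReal.coe_sub h₁] at h4
  linarith

lemma mem_minimalSolutions_of_min_restTime_le (hA : IsAdmissible φ g) (hu : IsDissipative φ g u)
    (h : ∀ v ∈ solutionsOnRange (dissipativeCurves φ g) u, ∀ t₀ t₁ : ℝ≥0, u t₀ = v t₁ →
      min (t₀ : ℝ≥0∞) (restTime u) ≤ (t₁ : ℝ≥0∞)) :
    u ∈ minimalSolutions (dissipativeCurves φ g) := by
  refine ⟨hu, fun v hv huv => ?_⟩
  have hvu := huv.mem_solutionsOnRange hA hu (self_mem_solutionsOnRange hA hu) hv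
  have hvd : IsDissipative φ g v := hv
  obtain ⟨-, -, hv2⟩ := (mem_solutionsOnRange_iff hA hu).1 hvu
  obtain ⟨z, -, hz, hzu⟩ := huv.exists_le
  have hzt : ∀ t : ℝ≥0, (t : ℝ≥0∞) ≤ restTime u → u t = v t := fun t ht => by
    have h1 := h v hvu t (z t) (hzu t)
    rw [min_eq_left ht, ENNReal.coe_le_coe] at h1
    rw [hzu t, le_antisymm (hz t) h1]
  funext t
  rcases le_or_gt (t : ℝ≥0∞) (restTime u) with ht | ht
  · exact hzt t ht
  obtain ⟨ρ, hρ⟩ : ∃ ρ : ℝ≥0, (ρ : ℝ≥0∞) = restTime u :=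
    ⟨(restTime u).toNNReal, ENNReal.coe_toNNReal (ht.trans ENNReal.coe_lt_top).ne⟩
  rw [← hρ, ENNReal.coe_lt_coe] at ht
  have hrest : ∀ s, ρ ≤ s → u s = u ρ := fun s hs => eq_of_restTime_le hu.continuous hρ.symm hs
  have hmin : ∀ s, energy φ u ρ ≤ energy φ u s := fun s => by
    rcases le_total ρ s with hs | hs
    · simp only [energy, hrest s hs, le_rfl]
    · exact hu.energy_antitone hs
  have hρv : u ρ = v ρ := hzt ρ hρ.le
  rw [(hu.isClosed_range_of_energy_le hmin).closure_eq] at hv2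
  obtain ⟨r, hr⟩ := hv2 (mem_range_self t)
  rw [hrest t ht.le, hρv]
  refine hvd.eq_of_energy_eq (le_antisymm ?_ (hvd.energy_antitone ht.le))
  have := hmin r
  simpa only [energy, hρv, hr] using this

/-! ### Functions decreasing along solutions -/

lemma apply_le_of_mem_minimalSolutions [CompleteSpace S] {α : Type*} [Preorder α] {Ψ : S → α}
    (hΨ : ∀ u, IsDissipative φ g u → ∀ s t : ℝ≥0, s < t → Ψ (u t) ≤ Ψ (u s))
    (hA : IsAdmissible φ g) (hu : u ∈ minimalSolutions (dissipativeCurves φ g))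
    (hv : IsDissipative φ g v) (huv : u ∈ solutionsOnRange (dissipativeCurves φ g) v) (t : ℝ≥0) :
    Ψ (u t) ≤ Ψ (v t) := by
  obtain ⟨z, -, hz, hzv⟩ := (succeeds_of_mem_minimalSolutions hA hv hu huv
    (self_mem_solutionsOnRange hA hv)).exists_le
  rw [hzv t]
  rcases (hz t).eq_or_lt with h | h
  · rw [h]
  · exact hΨ u hu.1 _ _ h

/-- If `u` succeeds `v`, then `v` has at time `z(t) ≤ t` the value of `u` at time `t`, so that
`Ψ ∘ v` is constant on `[z(t), t]`. As `Ψ` is injective on the range of `u`, this forces `v` to rest on this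
interval, and in particular it cannot leave the range of `u` there. -/
lemma mem_minimalSolutions_of_apply_le {α : Type*} [PartialOrder α] {Ψ : S → α}
    (hΨ : ∀ u, IsDissipative φ g u → ∀ s t : ℝ≥0, s < t → Ψ (u t) ≤ Ψ (u s))
    (hA : IsAdmissible φ g) (hu : IsDissipative φ g u) (hinj : InjOn Ψ (range u))
    (h : ∀ v ∈ solutionsOnRange (dissipativeCurves φ g) u, ∀ t, Ψ (u t) ≤ Ψ (v t)) :
    u ∈ minimalSolutions (dissipativeCurves φ g) := by
  refine ⟨hu, fun v hv huv => ?_⟩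
  have hvd : IsDissipative φ g v := hv
  have hvu := huv.mem_solutionsOnRange hA hu (self_mem_solutionsOnRange hA hu) hv
  obtain ⟨z, -, hz, hzu⟩ := huv.exists_le
  obtain ⟨θ, hθ, hin, hout⟩ := hvu.2.2.2
  have hΨ' : ∀ s t : ℝ≥0, s ≤ t → Ψ (v t) ≤ Ψ (v s) := fun s t hst => by
    rcases hst.eq_or_lt with rfl | hlt
    · exact le_rfl
    · exact hΨ v hvd s t hlt
  funext t
  have hconst : ∀ s, z t ≤ s → s ≤ t → v s ∈ range u → v s = u t := fun s hs hst hsu => by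
    refine hinj hsu (mem_range_self t) (le_antisymm ?_ ?_)
    · rw [hzu t]; exact hΨ' _ _ hs
    · exact (h v hvu t).trans (hΨ' _ _ hst)
  have hmem : ∀ s : ℝ≥0, (s : ℝ≥0∞) < θ → v s ∈ range u := fun s hs => hin ▸ mem_image_of_mem v hs
  rcases lt_or_ge (t : ℝ≥0∞) θ with ht | ht
  · exact (hconst t (hz t) le_rfl (hmem t ht)).symm
  exfalso
  lift θ to ℝ≥0 using (ht.trans_lt ENNReal.coe_lt_top).ne with c
  simp only [ENNReal.coe_lt_coe, ENNReal.coe_le_coe] at hin hout hmem ht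
  have hzc : z t < c := by
    by_contra! hcz
    exact (hout (mem_image_of_mem v hcz)).2 ⟨t, hzu t⟩
  have : NeBot (𝓝[<] c) := nhdsLT_neBot_of_exists_lt ⟨_, hzc⟩
  have hvc : v c = u t := by
    refine tendsto_nhds_unique ((hvd.continuous.tendsto c).mono_left
      (nhdsWithin_le_nhds (s := Iio c))) (tendsto_const_nhds.congr' ?_)
    filter_upwards [self_mem_nhdsWithin, mem_nhdsWithin_of_mem_nhds (Ioi_mem_nhds hzc)]
      with s hs hs'
    exact (hconst s (le_of_lt hs') ((le_of_lt hs).trans ht) (hmem s hs)).symm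
  exact (hout (mem_image_of_mem v (show c ∈ {t | c ≤ t} from le_refl c))).2 ⟨t, hvc.symm⟩

/-! ### Compactness of truncated solutions -/

/-- A truncated solution with finite rest time is a solution stopped at a finite time. -/
lemma exists_eq_apply_min {X : Type*} {U : Set (ℝ≥0 → X)} {v : ℝ≥0 → X} (hv : v ∈ truncated U)
    {M : ℝ≥0} (hM : restTime v < M) : ∃ u ∈ U, ∃ ρ ≤ M, ∀ t, v t = u (min t ρ) := by
  obtain ⟨u, hu, T, hT⟩ := hv
  obtain ⟨s, hsM, hs⟩ := exists_rest_of_restTime_lt hM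
  have hsM' := ENNReal.coe_lt_coe.1 hsM
  rcases le_total (s : ℝ≥0∞) T with h | h
  · refine ⟨u, hu, s, hsM'.le, fun t => ?_⟩
    have key : ∀ t ≤ s, v t = u t := fun t ht => by
      rw [hT t, min_eq_left ((ENNReal.coe_le_coe.2 ht).trans h), ENNReal.toNNReal_coe]
    rcases le_total t s with ht | ht
    · rw [min_eq_left ht, key t ht]
    · rw [min_eq_right ht, hs t ht, key s le_rfl]
  · lift T to ℝ≥0 using (h.trans_lt ENNReal.coe_lt_top).ne
    refine ⟨u, hu, T, (ENNReal.coe_le_coe.1 h).trans hsM'.le, fun t => ?_⟩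
    rw [hT t, ← ENNReal.coe_min, ENNReal.toNNReal_coe]

lemma range_apply_min {X : Type*} (u : ℝ≥0 → X) (ρ : ℝ≥0) :
    range (fun t => u (min t ρ)) = u '' Icc 0 ρ := by
  apply Subset.antisymm
  · rintro _ ⟨t, rfl⟩
    exact ⟨min t ρ, ⟨zero_le, min_le_right _ _⟩, rfl⟩
  · rintro _ ⟨t, ht, rfl⟩
    exact ⟨t, by simp only [min_eq_left ht.2]⟩

/-- The stopped solutions end at the same point, so that they may be continued by one of them; this
reduces the claim to the compactness of families of solutions. -/
theorem compactnessHypothesis_dissipativeCurves (hA : IsAdmissible φ g) :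
    CompactnessHypothesis (dissipativeCurves φ g) := by
  intro v hv hrest hrange
  obtain ⟨M, hM, -⟩ := ENNReal.lt_iff_exists_nnreal_btwn.1 hrest
  choose u hu ρ hρM hvu using fun n => exists_eq_apply_min (hv n) ((le_iSup _ n).trans_lt hM)
  have hu' : ∀ n, IsDissipative φ g (u n) := hu
  have hr : ∀ n, range (v n) = u n '' Icc 0 (ρ n) := fun n => by
    rw [← range_apply_min]; congr 1; funext t; exact hvu n t
  have himg : ∀ n, u n '' Icc 0 (ρ n) = u 0 '' Icc 0 (ρ 0) := fun n => by
    rw [← hr, ← hr, hrange n]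
  have hends := fun n => apply_eq_of_image_Icc_eq (hu' n) (hu' 0) zero_le zero_le (himg n)
  obtain ⟨b, -, k₁, hk₁, hb⟩ := isCompact_Icc.tendsto_subseq
    (fun n => (⟨zero_le, hρM n⟩ : ρ n ∈ Icc 0 M))
  -- Every `u n`, stopped at `ρ n`, is continued by the tail of `u 0`.
  have h0 : ∀ n, (fun s => u 0 (s + ρ 0)) 0 = u n (ρ n) := fun n => by
    simp only [zero_add, (hends n).2]
  obtain ⟨w, hw, -, k₂, hk₂, hlim⟩ := exists_subseq_tendsto_of_mem_image hA.lsc_slope (hu' 0)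
    (hA.continuous_energy _ (hu' 0))
    (U := fun n => concat (ρ (k₁ n)) (u (k₁ n)) (fun s => u 0 (s + ρ 0))) (c := fun t => t + ρ 0)
    (fun n => (hu' _).concat ((hu' 0).translation _) (h0 _)) (fun n t => by
      rcases concat_cases (u := u (k₁ n)) (v := fun s => u 0 (s + ρ 0)) (h0 (k₁ n)) t with
        ⟨ht, he⟩ | ⟨s, hs, he⟩
      · simp only [he]
        refine image_mono (Icc_subset_Icc_right le_add_self) ?_
        rw [← himg (k₁ n)]
        exact mem_image_of_mem _ ⟨zero_le, ht⟩
      · simp only [he]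
        refine ⟨s + ρ 0, ⟨zero_le, ?_⟩, rfl⟩
        rw [hs]
        gcongr
        exact le_add_self)
  have hconv : ∀ t, Tendsto (fun n => v (k₁ (k₂ n)) t) atTop (𝓝 (w (min t b))) := fun t => by
    have h1 := hlim (fun n => min t (ρ (k₁ (k₂ n)))) (min t b)
      (tendsto_const_nhds.min (hb.comp hk₂.tendsto_atTop))
    simp only [concat_apply_of_le (min_le_right _ _)] at h1
    simpa only [hvu] using h1
  have hwb : w b = u 0 (ρ 0) := by
    refine tendsto_nhds_unique (hlim (fun n => ρ (k₁ (k₂ n))) b (hb.comp hk₂.tendsto_atTop)) ?_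
    simp only [concat_apply_of_le le_rfl, (hends _).2]
    exact tendsto_const_nhds
  have hw0 : w 0 = u 0 0 := by
    refine tendsto_nhds_unique (hlim (fun _ => 0) 0 tendsto_const_nhds) ?_
    simp only [concat_apply_of_le (zero_le : (0 : ℝ≥0) ≤ _), (hends _).1]
    exact tendsto_const_nhds
  have hwR : ∀ t ≤ b, w t ∈ u 0 '' Icc 0 (ρ 0) := fun t ht => by
    have h1 := hconv t
    rw [min_eq_left ht] at h1
    refine (isCompact_Icc.image (hu' 0).continuous).isClosed.mem_of_tendsto h1
      (Eventually.of_forall fun n => ?_)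
    rw [← hr, ← hrange]
    exact mem_range_self _
  refine ⟨fun t => w (min t b), ⟨w, hw, b, fun t => ?_⟩, k₁ ∘ k₂, hk₁.comp hk₂, hconv, ?_⟩
  · rw [← ENNReal.coe_min, ENNReal.toNNReal_coe]
  rw [range_apply_min, hr]
  apply Subset.antisymm
  · rintro _ ⟨t, ht, rfl⟩
    exact hwR t ht.2
  · rintro _ ⟨s, hs, rfl⟩
    have e1 : energy φ w b ≤ energy φ (u 0) s := by
      have := (hu' 0).energy_antitone hs.2
      simpa only [energy, hwb] using this
    have e2 : energy φ (u 0) s ≤ energy φ w 0 := by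
      have := (hu' 0).energy_antitone hs.1
      simpa only [energy, hw0] using this
    obtain ⟨t, ht, hte⟩ := intermediate_value_Icc' (zero_le : 0 ≤ b)
      (hA.continuous_energy w hw).continuousOn ⟨e1, e2⟩
    exact ⟨t, ht, (hu' 0).injOn_toReal_range (image_subset_range _ _ (hwR t ht.2))
      (mem_range_self s) hte⟩

/-! ### The semiflow axioms -/

theorem isGeneralizedLambdaSemiflow_dissipativeCurves [CompleteSpace S] (hA : IsAdmissible φ g)
    (hne : (dissipativeCurves φ g).Nonempty) :
    IsGeneralizedLambdaSemiflow (dissipativeCurves φ g) where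
  nonempty := hne
  translation _ hu τ := IsDissipative.translation hu τ
  concatenation _ hu _ hv _ h := IsDissipative.concatenation hu hv h
  direction u hu v hv s t _ _ l₁ _ l₂ _ r₁ r₂ h₁ h₂ hne hr := by
    have hu : IsDissipative φ g u := hu
    have hv : IsDissipative φ g v := hv
    by_contra! hl
    have e1 := hu.energy_antitone hr.le
    have e2 := hv.energy_antitone hl
    simp only [energy, h₁, h₂] at e2
    exact hne (hu.eq_of_energy_eq (le_antisymm e2 e1))
  extension u hu θ w hw himg := by
    obtain ⟨A, B, hB, x₀, hq⟩ := hA.quadratic_bound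
    obtain ⟨x, hx, -, h⟩ := isDissipative_extension hA.ne_bot hA.lsc_energy hA.lsc_slope hB hq hu
      hw himg
    exact ⟨x, hx, h⟩
  locality _ hw := isDissipative_of_forall_Icc hw

end

end LambdaSemiflow

end

theorem mainTheorem7 {S : Type*} [MetricSpace S] [CompleteSpace S]
    (φ : S → EReal) (g : S → ℝ≥0∞)
    (hφ_bot : ∀ x, φ x ≠ ⊥)
    (hφ_lsc : LowerSemicontinuous φ) (hg_lsc : LowerSemicontinuous g)
    (hφ_quad : ∃ A B : ℝ, 0 < A ∧ 0 < B ∧ ∃ x₀ : S,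
      ∀ x, ((-A - B * dist x x₀ ^ 2 : ℝ) : EReal) ≤ φ x)
    (hne : (gradientFlow φ g).Nonempty)
    (hcont : ∀ u ∈ gradientFlow φ g, Continuous (fun t => φ (u t))) :
    IsGeneralizedLambdaSemiflow (gradientFlow φ g) ∧
    CompactnessHypothesis (gradientFlow φ g) ∧
    -- existence and uniqueness of minimal solutions with given range
    (∀ y ∈ gradientFlow φ g,
      ∃ u ∈ solutionsOnRange (gradientFlow φ g) y ∩ minimalSolutions (gradientFlow φ g),
        (∀ u' ∈ solutionsOnRange (gradientFlow φ g) y ∩ minimalSolutions (gradientFlow φ g),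
          u' = u) ∧
        ∀ v ∈ solutionsOnRange (gradientFlow φ g) y, Succeeds v u) ∧
    -- injectivity
    (∀ u ∈ minimalSolutions (gradientFlow φ g), InjOn u {t : ℝ≥0 | (t : ℝ≥0∞) < restTime u}) ∧
    -- minimal solutions reach every point of the range in minimal time
    (∀ u ∈ minimalSolutions (gradientFlow φ g), ∀ v ∈ gradientFlow φ g,
      u ∈ solutionsOnRange (gradientFlow φ g) v →
      ∀ t₀ t₁ : ℝ≥0, u t₀ = v t₁ → min (t₀ : ℝ≥0∞) (restTime u) ≤ (t₁ : ℝ≥0∞)) ∧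
    -- minimal solutions run through each piece of their range in minimal time
    (∀ u ∈ minimalSolutions (gradientFlow φ g), ∀ v ∈ gradientFlow φ g,
      ∀ s₀ t₀ s₁ t₁ : ℝ≥0, s₀ ≤ t₀ → s₁ ≤ t₁ → v '' Icc s₁ t₁ = u '' Icc s₀ t₀ →
        (min (t₀ : ℝ≥0∞) (restTime u)).toReal - (s₀ : ℝ) ≤ (t₁ : ℝ) - (s₁ : ℝ)) ∧
    -- a sufficient criterion for minimality
    (∀ u ∈ gradientFlow φ g,
      (∀ v ∈ solutionsOnRange (gradientFlow φ g) u, ∀ t₀ t₁ : ℝ≥0, u t₀ = v t₁ →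
        min (t₀ : ℝ≥0∞) (restTime u) ≤ (t₁ : ℝ≥0∞)) →
      u ∈ minimalSolutions (gradientFlow φ g)) ∧
    -- `φ` is finite and decreasing along every solution, and injective on its range
    (∀ u ∈ gradientFlow φ g,
      (∀ t, φ (u t) < ⊤) ∧ (∀ s t : ℝ≥0, s < t → φ (u t) ≤ φ (u s)) ∧ InjOn φ (range u)) ∧
    -- characterization of minimal solutions through `φ`
    (∀ u ∈ minimalSolutions (gradientFlow φ g), ∀ v ∈ gradientFlow φ g,
      u ∈ solutionsOnRange (gradientFlow φ g) v → ∀ t, φ (u t) ≤ φ (v t)) ∧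
    (∀ u ∈ gradientFlow φ g,
      (∀ v ∈ solutionsOnRange (gradientFlow φ g) u, ∀ t, φ (u t) ≤ φ (v t)) →
      u ∈ minimalSolutions (gradientFlow φ g)) ∧
    -- the same for every real function which decreases along solution curves
    (∀ Ψ : S → ℝ,
      (∀ u ∈ gradientFlow φ g, ∀ s t : ℝ≥0, s < t → Ψ (u t) ≤ Ψ (u s)) →
      (∀ u ∈ minimalSolutions (gradientFlow φ g), ∀ v ∈ gradientFlow φ g,
        u ∈ solutionsOnRange (gradientFlow φ g) v → ∀ t, Ψ (u t) ≤ Ψ (v t)) ∧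
      (∀ u ∈ gradientFlow φ g, InjOn Ψ (range u) →
        (∀ v ∈ solutionsOnRange (gradientFlow φ g) u, ∀ t, Ψ (u t) ≤ Ψ (v t)) →
        u ∈ minimalSolutions (gradientFlow φ g))) := by
  have hU : gradientFlow φ g = dissipativeCurves φ g :=
    Set.ext fun u => mem_gradientFlow_iff hφ_bot hg_lsc
  have hA : IsAdmissible φ g := by
    obtain ⟨A, B, -, hB, x₀, hq⟩ := hφ_quad
    refine ⟨hφ_bot, hφ_lsc, hg_lsc, ⟨A, B, hB, x₀, hq⟩, fun u hu => ?_⟩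
    rw [continuous_iff_continuousAt]
    intro t
    exact (EReal.tendsto_toReal (hu.ne_top t) (hφ_bot _)).comp
      ((hcont u (hU ▸ hu)).tendsto t)
  have hφanti : ∀ u, IsDissipative φ g u → ∀ s t : ℝ≥0, s < t → φ (u t) ≤ φ (u s) :=
    fun u hu s t hst => hu.antitone hφ_bot hst.le
  have hφinj : ∀ u, IsDissipative φ g u → InjOn φ (range u) :=
    fun u hu p hp q hq h => hu.injOn_toReal_range hp hq (congrArg EReal.toReal h)
  rw [hU] at hne ⊢
  refine ⟨isGeneralizedLambdaSemiflow_dissipativeCurves hA hne,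
    compactnessHypothesis_dissipativeCurves hA, fun y hy => ?_,
    fun u hu => injOn_of_mem_minimalSolutions hu,
    fun u hu v hv huv t₀ t₁ h => min_restTime_le_of_mem_minimalSolutions hA hu hv huv h,
    fun u hu v hv s₀ t₀ s₁ t₁ h₀ h₁ h => min_restTime_sub_le_of_image_eq hA hu hv h₀ h₁ h,
    fun u hu h => mem_minimalSolutions_of_min_restTime_le hA hu h,
    fun u hu => ⟨fun t => lt_top_iff_ne_top.2 (IsDissipative.ne_top hu t), hφanti u hu,
      hφinj u hu⟩,
    fun u hu v hv huv => apply_le_of_mem_minimalSolutions hφanti hA hu hv huv,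
    fun u hu h => mem_minimalSolutions_of_apply_le hφanti hA hu (hφinj u hu) h,
    fun Ψ hΨ => ⟨fun u hu v hv huv => apply_le_of_mem_minimalSolutions hΨ hA hu hv huv,
      fun u hu hinj h => mem_minimalSolutions_of_apply_le hΨ hA hu hinj h⟩⟩
  obtain ⟨u, hu, h⟩ := exists_minimalSolution hA hy
  exact ⟨u, hu, fun u' hu' => hu'.2.2 u hu.2.1 (h u' hu'.1), h⟩
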